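/- Let $G$ be a group with a finite generating set $S$, and let $d_S$ be the word metric on $G$, i.e. $d_S(g,h)$ is the least $n$ such that $g^{-1}h$ is a product of $n$ elements of $S\cup S^{-1}$. For a metric space $(X,d)$ and $n\ge 0$ let $C_n^{\mathrm{uf}}(X;\mathbb R)$ be the real vector space of bounded functions $c\colon X^{n+1}\to\mathbb R$, written as formal sums $\sum_{x}c(x)\,x$, such that - for every $r>0$ there is a constant $K_r$ such that every ball of radius $r$ in $X^{n+1}$ (with the maximum metric) contains at most $K_r$ points $x$ with $c(x)\ne 0$; - there is an $R>0$ such that $c(x_0,\dots,x_n)=0$ whenever $d(x_i,x_j)>R$ for some $i,j$. With the boundary operators $\partial_n(x_0,\dots,x_n)=\sum_{j=0}^n(-1)^j(x_0,\dots,\widehat{x_j},\dots,x_n)$ (for $n\geq 1$) these spaces form a chain complex, whose homology is the uniformly finite homology $H_*^{\mathrm{uf}}(X;\mathbb R)$. Write $H_*^{\mathrm{uf}}(G;\mathbb R)$ for the uniformly finite homology of $(G,d_S)$. Assume that $G$ is amenable, i.e. that there is a linear map $m\colon\ell^\infty(G)\to\mathbb R$ with $m(1)=1$, with $m(\varphi)\ge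 0$ whenever $\varphi\ge 0$, and with $m(g\cdot\varphi)=m(\varphi)$ for all $g\in G$ and $\varphi\in\ell^\infty(G)$, where $(g\cdot\varphi)(g')=\varphi(g^{-1}g')$. Assume moreover that the abelianization of $G$ is not a torsion group. Then: 1. if $G$ is virtually $\mathbb Z$ (i.e. has a subgroup of finite index isomorphic to $\mathbb Z$), then $H_1^{\mathrm{uf}}(G;\mathbb R)\cong\mathbb R$ as real vector spaces; 2. if $G$ is not virtually $\mathbb Z$, then $H_1^{\mathrm{uf}}(G;\mathbb R)$ is an infinite dimensional real vector space. -/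

import Mathlib

open scoped ENNReal

section UniformlyFiniteHomology

variable {X : Type*} [MetricSpace X]

/-- Conditions for `c : X ^ (n + 1) → ℝ` to be a uniformly finite `n`-chain of the metric space `X`.
The type `Fin (n + 1) → X` carries the maximum metric. -/
structure IsUFChain {n : ℕ} (c : (Fin (n + 1) → X) → ℝ) : Prop where
  /-- `c` is bounded. -/
  bounded : ∃ M : ℝ, ∀ x, |c x| ≤ M
  /-- For every `r > 0` the number of points of the support of `c` in a ball of radius `r` is finite
  and bounded independently of the centre of the ball. -/
  locallyFinite : ∀ r : ℝ, 0 < r → ∃ K : ℕ, ∀ y : Fin (n + 1) → X,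
    {x | x ∈ Metric.closedBall y r ∧ c x ≠ 0}.encard ≤ (K : ℕ∞)
  /-- The simplices in the support of `c` have uniformly bounded diameter. -/
  controlled : ∃ R : ℝ, 0 < R ∧ ∀ x, (∃ i j, R < dist (x i) (x j)) → c x = 0

variable (X) in
/-- The uniformly finite `n`-chains of `X` as a linear subspace of all functions on `X ^ (n + 1)`. -/
def ufChainSubmodule (n : ℕ) : Submodule ℝ ((Fin (n + 1) → X) → ℝ) where
  carrier := {c | IsUFChain c}
  zero_mem' := ⟨⟨0, by simp⟩, fun r _ => ⟨0, by simp⟩, ⟨1, one_pos, by simp⟩⟩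
  add_mem' := by
    rintro a b ⟨⟨M, hM⟩, ha, ⟨R, hR, hR'⟩⟩ ⟨⟨N, hN⟩, hb, ⟨Q, hQ, hQ'⟩⟩
    refine ⟨⟨M + N, fun x => (abs_add_le _ _).trans (add_le_add (hM x) (hN x))⟩, fun r hr => ?_,
      ⟨max R Q, lt_max_of_lt_left hR, ?_⟩⟩
    · obtain ⟨K, hK⟩ := ha r hr
      obtain ⟨L, hL⟩ := hb r hr
      refine ⟨K + L, fun y => ?_⟩
      rw [Nat.cast_add]
      refine le_trans (Set.encard_le_encard ?_)
        ((Set.encard_union_le _ _).trans (add_le_add (hK y) (hL y)))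
      rintro x ⟨hx, h⟩
      by_cases h0 : a x = 0
      · exact Or.inr ⟨hx, by simpa [h0] using h⟩
      · exact Or.inl ⟨hx, h0⟩
    · rintro x ⟨i, j, h⟩
      simp [hR' x ⟨i, j, lt_of_le_of_lt (le_max_left _ _) h⟩,
        hQ' x ⟨i, j, lt_of_le_of_lt (le_max_right _ _) h⟩]
  smul_mem' := by
    rintro t a ⟨⟨M, hM⟩, ha, ⟨R, hR, hR'⟩⟩
    refine ⟨⟨|t| * M, fun x => ?_⟩, fun r hr => ?_, ⟨R, hR, fun x hx => by simp [hR' x hx]⟩⟩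
    · simpa [abs_mul] using mul_le_mul_of_nonneg_left (hM x) (abs_nonneg t)
    · obtain ⟨K, hK⟩ := ha r hr
      refine ⟨K, fun y => le_trans (Set.encard_le_encard ?_) (hK y)⟩
      rintro x ⟨hx, h⟩
      exact ⟨hx, fun h0 => h (by simp [h0])⟩

variable (X) in
/-- The real vector space `C_n^{uf}(X; ℝ)` of uniformly finite `n`-chains of `X`. -/
def UFChain (n : ℕ) : Type _ := ufChainSubmodule X n

instance UFChain.instAddCommGroup (n : ℕ) : AddCommGroup (UFChain X n) :=
  inferInstanceAs (AddCommGroup (ufChainSubmodule X n))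

instance UFChain.instModule (n : ℕ) : Module ℝ (UFChain X n) :=
  inferInstanceAs (Module ℝ (ufChainSubmodule X n))

/-- The chain `∑ c(x) · (x₀, …, x̂ⱼ, …, xₙ₊₁)`: its value at `y` is the sum of `c` over all `x` which
become `y` when the `j`-th entry is deleted, i.e. over all `x` obtained from `y` by inserting
some `z : X` at position `j`. -/
noncomputable def ufFaceFun {n : ℕ} (j : Fin (n + 2)) (c : (Fin (n + 2) → X) → ℝ) :
    (Fin (n + 1) → X) → ℝ :=
  fun y => ∑ᶠ z : X, c (j.insertNth z y)

theorem IsUFChain.mem_closedBall {n : ℕ} {c : (Fin (n + 1) → X) → ℝ} {R : ℝ} (hR : 0 < R)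
    (h : ∀ x, (∃ i j, R < dist (x i) (x j)) → c x = 0) {x : Fin (n + 1) → X} (hx : c x ≠ 0)
    (k : Fin (n + 1)) : x ∈ Metric.closedBall (fun _ => x k : Fin (n + 1) → X) R := by
  rw [Metric.mem_closedBall, dist_pi_le_iff hR.le]
  intro i
  by_contra h'
  exact hx (h x ⟨i, k, not_le.1 h'⟩)

theorem IsUFChain.exists_fiber_bound {n : ℕ} {c : (Fin (n + 2) → X) → ℝ} (hc : IsUFChain c)
    (j : Fin (n + 2)) :
    ∃ K : ℕ, ∀ y : Fin (n + 1) → X, {z | c (j.insertNth z y) ≠ 0}.encard ≤ (K : ℕ∞) := by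
  obtain ⟨R, hR, hR'⟩ := hc.controlled
  obtain ⟨K, hK⟩ := hc.locallyFinite R hR
  refine ⟨K, fun y => le_trans ?_ (hK (fun _ => y 0))⟩
  rw [← (Fin.insertNth_left_injective (α := fun _ => X) (p := j) y).encard_image]
  refine Set.encard_le_encard ?_
  rintro _ ⟨z, hz, rfl⟩
  have := IsUFChain.mem_closedBall hR hR' hz (j.succAbove 0)
  simp only [Fin.insertNth_apply_succAbove] at this
  exact ⟨this, hz⟩

theorem IsUFChain.finite_fiber {n : ℕ} {c : (Fin (n + 2) → X) → ℝ} (hc : IsUFChain c)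
    (j : Fin (n + 2)) (y : Fin (n + 1) → X) :
    (Function.support fun z => c (j.insertNth z y)).Finite := by
  obtain ⟨K, hK⟩ := hc.exists_fiber_bound j
  exact Set.finite_of_encard_le_coe (hK y)

theorem IsUFChain.face {n : ℕ} {c : (Fin (n + 2) → X) → ℝ} (hc : IsUFChain c)
    (j : Fin (n + 2)) : IsUFChain (ufFaceFun j c) := by
  obtain ⟨M, hM⟩ := hc.bounded
  obtain ⟨R, hR, hR'⟩ := hc.controlled
  refine ⟨?_, fun r hr => ?_, ⟨R, hR, ?_⟩⟩
  · obtain ⟨K, hK⟩ := hc.exists_fiber_bound j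
    refine ⟨K * M, fun y => ?_⟩
    have hM0 : 0 ≤ M := (abs_nonneg _).trans (hM (fun _ => y 0))
    have hf := hc.finite_fiber j y
    rw [ufFaceFun, finsum_eq_sum_of_support_subset (s := hf.toFinset) _ (by simp)]
    have h1 : ((hf.toFinset.card : ℕ) : ℝ) ≤ K := by
      have := hK y
      change (Function.support fun z => c (j.insertNth z y)).encard ≤ _ at this
      rw [hf.encard_eq_coe_toFinset_card] at this
      exact_mod_cast this
    calc |∑ z ∈ hf.toFinset, c (j.insertNth z y)|
        ≤ ∑ z ∈ hf.toFinset, |c (j.insertNth z y)| := Finset.abs_sum_le_sum_abs _ _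
      _ ≤ hf.toFinset.card • M := Finset.sum_le_card_nsmul _ _ _ fun z _ => hM _
      _ ≤ K * M := by
        rw [nsmul_eq_mul]
        exact mul_le_mul_of_nonneg_right h1 hM0
  · obtain ⟨K, hK⟩ := hc.locallyFinite (R + r) (by positivity)
    refine ⟨K, fun y => le_trans ?_ (hK (j.insertNth (y 0) y))⟩
    refine le_trans (Set.encard_le_encard ?_) (Set.encard_image_le (fun x => j.removeNth x) _)
    rintro x ⟨hx, h⟩
    obtain ⟨z, hz⟩ : ∃ z, c (j.insertNth z x) ≠ 0 := by
      by_contra h'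
      push Not at h'
      exact h (by simp [ufFaceFun, h'])
    refine ⟨j.insertNth z x, ⟨?_, hz⟩, by simp⟩
    rw [Metric.mem_closedBall, dist_pi_le_iff hr.le] at hx
    rw [Metric.mem_closedBall, dist_pi_le_iff (by positivity)]
    intro i
    rcases Fin.eq_self_or_eq_succAbove j i with rfl | ⟨k, rfl⟩
    · simp only [Fin.insertNth_apply_same]
      refine (dist_triangle _ (x 0) _).trans (add_le_add ?_ (hx 0))
      by_contra h'
      exact hz (hR' _ ⟨i, i.succAbove 0, by simpa using h'⟩)
    · simp only [Fin.insertNth_apply_succAbove]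
      linarith [hx k]
  · rintro x ⟨i, k, h⟩
    have : ∀ z, c (j.insertNth z x) = 0 := fun z =>
      hR' _ ⟨j.succAbove i, j.succAbove k, by simpa using h⟩
    simp [ufFaceFun, this]

/-- The `j`-th face operator `(x₀, …, xₙ₊₁) ↦ (x₀, …, x̂ⱼ, …, xₙ₊₁)` on uniformly finite chains. -/
noncomputable def ufFace {n : ℕ} (j : Fin (n + 2)) : UFChain X (n + 1) →ₗ[ℝ] UFChain X n where
  toFun c := ⟨ufFaceFun j c.1, IsUFChain.face c.2 j⟩
  map_add' a b := by
    refine Subtype.ext (funext fun y => ?_)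
    exact finsum_add_distrib (IsUFChain.finite_fiber a.2 j y) (IsUFChain.finite_fiber b.2 j y)
  map_smul' t a := by
    refine Subtype.ext (funext fun y => ?_)
    exact (smul_finsum t fun z => a.1 (j.insertNth z y)).symm

variable (X) in
/-- The boundary operator `C_{n+1}(X; ℝ) → C_n(X; ℝ)`, the alternating sum of the faces. -/
noncomputable def ufBoundary (n : ℕ) : UFChain X (n + 1) →ₗ[ℝ] UFChain X n :=
  ∑ j : Fin (n + 2), (-1 : ℝ) ^ (j : ℕ) • ufFace j

theorem ufFace_ufFace {n : ℕ} (i : Fin (n + 3)) (j : Fin (n + 2)) (c : UFChain X (n + 2)) :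
    ufFace j (ufFace i c) = ufFace (j.predAbove i) (ufFace (i.succAbove j) c) := by
  refine Subtype.ext (funext fun y => ?_)
  have key : ∀ z w : X, (i.insertNth w (j.insertNth z y : Fin (n + 2) → X) : Fin (n + 3) → X) =
      (i.succAbove j).insertNth z ((j.predAbove i).insertNth w y : Fin (n + 2) → X) := by
    intro z w
    rw [Fin.eq_insertNth_iff, Fin.eq_insertNth_iff, ← Fin.removeNth_removeNth_eq_swap]
    refine ⟨by simp, ?_, by simp⟩
    rw [Fin.removeNth, Fin.succAbove_succAbove_predAbove, Fin.insertNth_apply_same]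
  have hfin : (Function.support fun p : X × X =>
      c.1 (i.insertNth p.2 (j.insertNth p.1 y : Fin (n + 2) → X))).Finite := by
    obtain ⟨R, hR, hR'⟩ := c.2.controlled
    obtain ⟨K, hK⟩ := c.2.locallyFinite R hR
    refine Set.Finite.of_injOn (f := fun p : X × X =>
      (i.insertNth p.2 (j.insertNth p.1 y : Fin (n + 2) → X) : Fin (n + 3) → X)) ?_ ?_
      (Set.finite_of_encard_le_coe (hK fun _ => y 0))
    · intro p hp
      have := IsUFChain.mem_closedBall hR hR' hp (i.succAbove (j.succAbove 0))
      simp only [Fin.insertNth_apply_succAbove] at this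
      exact ⟨this, hp⟩
    · rintro ⟨a, b⟩ _ ⟨a', b'⟩ _ h
      have h1 := Fin.insertNth_injective2 (α := fun _ => X) h
      have h2 := Fin.insertNth_injective2 (α := fun _ => X) h1.2
      exact Prod.ext h2.1 h1.1
  have hfin' : (Function.support fun p : X × X =>
      c.1 (i.insertNth p.1 (j.insertNth p.2 y : Fin (n + 2) → X))).Finite := by
    refine Set.Finite.subset (hfin.image Prod.swap) ?_
    rintro ⟨a, b⟩ h
    exact ⟨(b, a), h, rfl⟩
  change (∑ᶠ z, ∑ᶠ w, c.1 (i.insertNth w (j.insertNth z y : Fin (n + 2) → X))) =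
    ∑ᶠ w, ∑ᶠ z, c.1 ((i.succAbove j).insertNth z ((j.predAbove i).insertNth w y : Fin (n + 2) → X))
  simp_rw [← key]
  rw [← finsum_curry _ hfin, ← finsum_curry _ hfin']
  exact finsum_comp_equiv (Equiv.prodComm X X)
    (f := fun p : X × X => c.1 (i.insertNth p.1 (j.insertNth p.2 y : Fin (n + 2) → X)))

/-- The boundary operators form a chain complex. -/
theorem ufBoundary_ufBoundary (n : ℕ) (c : UFChain X (n + 2)) :
    ufBoundary X n (ufBoundary X (n + 1) c) = 0 := by
  simp only [ufBoundary, LinearMap.sum_apply, LinearMap.smul_apply, map_sum, map_smul,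
    Finset.smul_sum, smul_smul, ← pow_add]
  rw [Finset.sum_sigma']
  refine Finset.sum_involution
    (fun p _ => ⟨p.1.succAbove p.2, p.2.predAbove p.1⟩) ?_ ?_ ?_ ?_
  · rintro ⟨i, j⟩ -
    simp only
    rw [Fin.neg_one_pow_succAbove_add_predAbove, ufFace_ufFace i j, neg_smul, add_neg_cancel]
  · rintro ⟨i, j⟩ - - h
    exact Fin.succAbove_ne _ _ (congrArg Sigma.fst h)
  · simp
  · rintro ⟨i, j⟩ -
    simp [Fin.succAbove_succAbove_predAbove, Fin.predAbove_predAbove_succAbove]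

variable (X) in
/-- The `n`-cycles: the kernel of the boundary operator on `n`-chains, which is zero for `n = 0`. -/
noncomputable def ufCycles : (n : ℕ) → Submodule ℝ (UFChain X n)
  | 0 => ⊤
  | n + 1 => LinearMap.ker (ufBoundary X n)

variable (X) in
/-- The `n`-boundaries. -/
noncomputable def ufBoundaries (n : ℕ) : Submodule ℝ (UFChain X n) :=
  LinearMap.range (ufBoundary X n)

theorem ufBoundaries_le_ufCycles : ∀ n : ℕ, ufBoundaries X n ≤ ufCycles X n
  | 0 => le_top
  | n + 1 => by
    rintro _ ⟨c, rfl⟩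
    exact ufBoundary_ufBoundary n c

variable (X) in
/-- Uniformly finite homology `H_n^{uf}(X; ℝ)`: cycles modulo boundaries. -/
abbrev UFHomology (n : ℕ) : Type _ :=
  ufCycles X n ⧸ (ufBoundaries X n).submoduleOf (ufCycles X n)

end UniformlyFiniteHomology

section Groups

variable {G : Type*} [Group G]

/-- The distance of `g` and `h` in the word metric with respect to `S`: the least `n` such that
`g⁻¹ * h` is a product of `n` elements of `S ∪ S⁻¹`. -/
noncomputable def wordDist (S : Set G) (g h : G) : ℕ :=
  sInf {n : ℕ | ∃ l : List G, l.length = n ∧ (∀ s ∈ l, s ∈ S ∪ S⁻¹) ∧ l.prod = g⁻¹ * h}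

theorem exists_word {S : Set G} (hS : Subgroup.closure S = ⊤) (g h : G) :
    ∃ l : List G, l.length = wordDist S g h ∧ (∀ s ∈ l, s ∈ S ∪ S⁻¹) ∧ l.prod = g⁻¹ * h := by
  have hmem : g⁻¹ * h ∈ Submonoid.closure (S ∪ S⁻¹) := by
    rw [← Subgroup.closure_toSubmonoid, hS]
    trivial
  obtain ⟨l, hl, hl'⟩ := Submonoid.exists_list_of_mem_closure hmem
  exact Nat.sInf_mem (s := {n : ℕ | ∃ l : List G, l.length = n ∧ (∀ s ∈ l, s ∈ S ∪ S⁻¹) ∧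
    l.prod = g⁻¹ * h}) ⟨_, l, rfl, hl, hl'⟩

theorem wordDist_le {S : Set G} {g h : G} (l : List G) (hl : ∀ s ∈ l, s ∈ S ∪ S⁻¹)
    (h' : l.prod = g⁻¹ * h) : wordDist S g h ≤ l.length :=
  Nat.sInf_le ⟨l, rfl, hl, h'⟩

theorem wordDist_comm_le {S : Set G} (hS : Subgroup.closure S = ⊤) (g h : G) :
    wordDist S g h ≤ wordDist S h g := by
  obtain ⟨l, h1, h2, h3⟩ := exists_word hS h g
  rw [← h1]
  have := wordDist_le (S := S) (g := g) (h := h) (l.map (·⁻¹)).reverse ?_ ?_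
  · simpa using this
  · intro s hs
    simp only [List.mem_reverse, List.mem_map] at hs
    obtain ⟨a, ha, rfl⟩ := hs
    rcases h2 a ha with h | h
    · exact Or.inr (by simpa using h)
    · exact Or.inl h
  · rw [← List.prod_inv_reverse, h3]
    group

theorem wordDist_self (S : Set G) (g : G) : wordDist S g g = 0 :=
  Nat.le_zero.1 (wordDist_le [] (by simp) (by simp))

theorem wordDist_triangle {S : Set G} (hS : Subgroup.closure S = ⊤) (g h k : G) :
    wordDist S g k ≤ wordDist S g h + wordDist S h k := by
  obtain ⟨l, h1, h2, h3⟩ := exists_word hS g h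
  obtain ⟨l', h1', h2', h3'⟩ := exists_word hS h k
  rw [← h1, ← h1', ← List.length_append]
  refine wordDist_le _ (fun s hs => ?_) (by rw [List.prod_append, h3, h3']; group)
  rcases List.mem_append.1 hs with hs | hs
  · exact h2 s hs
  · exact h2' s hs

theorem eq_of_wordDist_eq_zero {S : Set G} (hS : Subgroup.closure S = ⊤) {g h : G}
    (h0 : wordDist S g h = 0) : g = h := by
  obtain ⟨l, h1, -, h3⟩ := exists_word hS g h
  rw [h0, List.length_eq_zero_iff] at h1
  rw [h1, List.prod_nil] at h3
  exact inv_mul_eq_one.1 h3.symm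

/-- The group `G`, viewed as a metric space with the word metric with respect to the
generating set `S`. -/
def WordMetricSpace (S : Set G) (_hS : Subgroup.closure S = ⊤) : Type _ := G

noncomputable instance WordMetricSpace.instMetricSpace (S : Set G) (hS : Subgroup.closure S = ⊤) :
    MetricSpace (WordMetricSpace S hS) where
  dist g h := (wordDist (G := G) S g h : ℝ)
  dist_self g := by exact_mod_cast wordDist_self (G := G) S g
  dist_comm g h := by
    exact_mod_cast le_antisymm (wordDist_comm_le hS g h) (wordDist_comm_le hS h g)
  dist_triangle g h k := by exact_mod_cast wordDist_triangle (G := G) hS g h k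
  eq_of_dist_eq_zero hgh := eq_of_wordDist_eq_zero (G := G) hS (by exact_mod_cast hgh)

/-- The left action of `G` on bounded functions: `(g • φ)(g') = φ(g⁻¹ * g')`. -/
def leftTranslate (g : G) (φ : lp (fun _ : G => ℝ) ∞) : lp (fun _ : G => ℝ) ∞ :=
  ⟨fun x => φ (g⁻¹ * x), by
    obtain ⟨C, hC⟩ := memℓp_infty_iff.1 (lp.memℓp φ)
    refine memℓp_infty_iff.2 ⟨C, ?_⟩
    rintro _ ⟨x, rfl⟩
    exact hC ⟨g⁻¹ * x, rfl⟩⟩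

/-- A left invariant mean on `G`. -/
structure IsLeftInvariantMean (m : lp (fun _ : G => ℝ) ∞ →ₗ[ℝ] ℝ) : Prop where
  map_one : m 1 = 1
  nonneg : ∀ φ : lp (fun _ : G => ℝ) ∞, (∀ g, 0 ≤ φ g) → 0 ≤ m φ
  invariant : ∀ (g : G) (φ : lp (fun _ : G => ℝ) ∞), m (leftTranslate g φ) = m φ

variable (G) in
/-- A (discrete) group is amenable if it admits a left invariant mean. -/
def IsAmenableGroup : Prop :=
  ∃ m : lp (fun _ : G => ℝ) ∞ →ₗ[ℝ] ℝ, IsLeftInvariantMean m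

variable (G) in
/-- A group is virtually `ℤ` if it has a subgroup of finite index which is infinite cyclic. -/
def IsVirtuallyInt : Prop :=
  ∃ H : Subgroup G, H.FiniteIndex ∧ Nonempty (H ≃* Multiplicative ℤ)

end Groups

/-! ### Balls in the word metric and the shape of uniformly finite chains -/

section WordMetric

variable {G : Type*} [Group G]

/-! Since the abelianization is finitely generated and not torsion, there are a homomorphism `φ : G
→ ℤ` and a `g` with `φ g > 0`. A `1`-chain `c` yields the function `x ↦ ∑ φ(x⁻¹y) c(x, y)`, summed
over `y`. If `c` is a boundary, this is a finite linear combination of functions `β(xs⁻¹) - β(x)`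
with `β` bounded (`finsum_mul_triangleBoundary`). Amenability provides a Reiter sequence, whose
averages of such differences tend to zero. If `f` is bounded and right invariant under `g`, then `∑
f(x) · (x, xg)` is a cycle, and it can bound only if the averages of `f` tend to zero
(`IsReiterSequence.tendsto_of_flowChain_eq`).

If `G` is not virtually `ℤ`, then `⟨g⟩` has infinite index. By B. H. Neumann's lemma the members of
the Reiter sequence can be translated from the left until their supports meet pairwise disjoint sets
of cosets of `⟨g⟩` (`IsReiterSequence.exists_disjoint`). Splitting the index set into infinitely
many infinite classes gives one coset indicator per class. Averaging along a single class tells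
these functions apart, so their cycles are linearly independent in homology.

If `G` is virtually `ℤ`, then `φ` has finite kernel and `G` is coarsely a line. A cycle has the same
flux through every cut of the line. If that flux vanishes, the cycle is a sum of closed slabs, each
of bounded size, and coning them off shows that it bounds
(`IsCoarseLine.triangleBoundary_slabCone`). So the homology has dimension at most one, and the cycle
with `f = 1` has averages equal to `1` and does not bound. -/

theorem finite_wordDist_le {S : Set G} (hfin : S.Finite) (hS : Subgroup.closure S = ⊤) (n : ℕ) :
    {g : G | wordDist S 1 g ≤ n}.Finite := by
  have hfin' : (S ∪ S⁻¹).Finite := hfin.union hfin.inv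
  have : Finite ↥(S ∪ S⁻¹) := hfin'
  refine ((List.finite_length_le ↥(S ∪ S⁻¹) n).image
    fun l => (l.map Subtype.val).prod).subset ?_
  intro g hg
  obtain ⟨l, h1, h2, h3⟩ := exists_word hS 1 g
  lift l to List ↥(S ∪ S⁻¹) using h2
  exact ⟨l, by simpa [← h1] using hg, by simpa using h3⟩

theorem wordDist_one_inv_mul (S : Set G) (g h : G) : wordDist S 1 (g⁻¹ * h) = wordDist S g h := by
  simp [wordDist]

/-- On a finitely generated group, the uniformly finite chains are the bounded functions whose
support consists of simplices of finitely many shapes. -/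
theorem isUFChain_iff {S : Set G} (hfin : S.Finite) (hS : Subgroup.closure S = ⊤) {n : ℕ}
    (c : (Fin (n + 1) → WordMetricSpace S hS) → ℝ) :
    IsUFChain c ↔ (∃ M : ℝ, ∀ x, |c x| ≤ M) ∧
      ∃ T : Finset G, ∀ x : Fin (n + 1) → G, c x ≠ 0 → ∀ j, (x 0)⁻¹ * x j ∈ T := by
  have hdist : ∀ x y : G, dist (α := WordMetricSpace S hS) x y = (wordDist S 1 (x⁻¹ * y) : ℝ) := by
    intro x y
    rw [wordDist_one_inv_mul]
    rfl
  constructor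
  · rintro ⟨h1, -, R, hR, h3⟩
    refine ⟨h1, (finite_wordDist_le hfin hS ⌊R⌋₊).toFinset, fun x hx j => ?_⟩
    rw [Set.Finite.mem_toFinset, Set.mem_ofPred_eq]
    apply Nat.le_floor
    rw [← hdist]
    by_contra hlt
    exact hx (h3 x ⟨0, j, not_le.1 hlt⟩)
  · rintro ⟨h1, T, hT⟩
    refine ⟨h1, fun r hr => ?_, ?_⟩
    -- Local finiteness is automatic: coordinatewise left translation carries any ball of radius `r`
    -- into one fixed finite product of balls about `1`.
    · set B := {g : G | wordDist S 1 g ≤ ⌊r⌋₊}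
      have hB : (Set.univ.pi fun _ : Fin (n + 1) => B).Finite :=
        Set.Finite.pi fun _ => finite_wordDist_le hfin hS _
      refine ⟨hB.toFinset.card, fun y => ?_⟩
      rw [← hB.encard_eq_coe_toFinset_card]
      have hinj : Function.Injective fun (x : Fin (n + 1) → G) (i : Fin (n + 1)) =>
          (show G from y i)⁻¹ * x i := by
        intro x x' h
        ext i
        exact mul_left_cancel (congrFun h i)
      refine le_trans (le_of_eq (hinj.encard_image _).symm) (Set.encard_le_encard ?_)
      rintro _ ⟨x, ⟨hx, -⟩, rfl⟩ i -
      apply Nat.le_floor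
      exact (hdist (y i) (x i)).symm.trans_le ((dist_comm (y i) _).trans_le
        ((dist_pi_le_iff hr.le).1 (Metric.mem_closedBall.1 hx) i))
    · have hfinU : ((fun p : G × G => (wordDist S 1 (p.1⁻¹ * p.2) : ℝ)) ''
          ((T : Set G) ×ˢ (T : Set G))).Finite := ((T.finite_toSet).prod T.finite_toSet).image _
      obtain ⟨R, hR⟩ := hfinU.bddAbove
      refine ⟨max R 1, by positivity, fun x => ?_⟩
      rintro ⟨i, j, hij⟩
      by_contra hx
      have hij' := lt_of_lt_of_eq hij (hdist (x i) (x j))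
      have hg : ∀ a b d : G, (a⁻¹ * b)⁻¹ * (a⁻¹ * d) = b⁻¹ * d := by intros; group
      have := hR ⟨(_, _), ⟨hT x hx i, hT x hx j⟩,
        congrArg (fun g : G => (wordDist S 1 g : ℝ)) (hg (x 0) (x i) (x j))⟩
      exact absurd (lt_of_le_of_lt (le_max_left _ _) hij') (not_lt.2 this)

end WordMetric

/-! ### Chains and boundaries in degrees one and two, in coordinates -/

section Chains

variable {G : Type*} [Group G]

/-- Uniformly finite `1`-chains of a group, as functions of two variables. -/
structure IsUFEdgeChain (c : G → G → ℝ) : Prop where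
  bounded : ∃ M : ℝ, ∀ x y, |c x y| ≤ M
  controlled : ∃ T : Finset G, ∀ x y, c x y ≠ 0 → x⁻¹ * y ∈ T

/-- Uniformly finite `2`-chains of a group, as functions of three variables. -/
structure IsUFTriangleChain (b : G → G → G → ℝ) : Prop where
  bounded : ∃ M : ℝ, ∀ x y z, |b x y z| ≤ M
  controlled : ∃ T : Finset G, ∀ x y z, b x y z ≠ 0 → x⁻¹ * y ∈ T ∧ x⁻¹ * z ∈ T

/-- The boundary of a `1`-chain. -/
noncomputable def edgeBoundary (c : G → G → ℝ) (y : G) : ℝ :=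
  ∑ᶠ z, c z y - ∑ᶠ z, c y z

/-- The boundary of a `2`-chain. -/
noncomputable def triangleBoundary (b : G → G → G → ℝ) (x y : G) : ℝ :=
  ∑ᶠ z, b z x y - ∑ᶠ z, b x z y + ∑ᶠ z, b x y z

variable {S : Set G} (hfin : S.Finite) (hS : Subgroup.closure S = ⊤)
include hfin

theorem isUFChain_edge_iff (c : G → G → ℝ) :
    IsUFChain (X := WordMetricSpace S hS) (n := 1) (fun x => c (x 0) (x 1)) ↔
      IsUFEdgeChain c := by
  classical
  rw [isUFChain_iff hfin]
  constructor
  · rintro ⟨⟨M, hM⟩, T, hT⟩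
    exact ⟨⟨M, fun x y => hM ![x, y]⟩, ⟨T, fun x y h => hT ![x, y] h 1⟩⟩
  · rintro ⟨⟨M, hM⟩, T, hT⟩
    refine ⟨⟨M, fun x => hM _ _⟩, insert 1 T, fun x hx j => ?_⟩
    fin_cases j
    · simp
    · exact Finset.mem_insert_of_mem (hT _ _ hx)

theorem isUFChain_triangle_iff (b : G → G → G → ℝ) :
    IsUFChain (X := WordMetricSpace S hS) (n := 2) (fun x => b (x 0) (x 1) (x 2)) ↔
      IsUFTriangleChain b := by
  classical
  rw [isUFChain_iff hfin]
  constructor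
  · rintro ⟨⟨M, hM⟩, T, hT⟩
    exact ⟨⟨M, fun x y z => hM ![x, y, z]⟩,
      ⟨T, fun x y z h => ⟨hT ![x, y, z] h 1, hT ![x, y, z] h 2⟩⟩⟩
  · rintro ⟨⟨M, hM⟩, T, hT⟩
    refine ⟨⟨M, fun x => hM _ _ _⟩, insert 1 T, fun x hx j => ?_⟩
    fin_cases j
    · simp
    · exact Finset.mem_insert_of_mem (hT _ _ _ hx).1
    · exact Finset.mem_insert_of_mem (hT _ _ _ hx).2

/-- The uniformly finite `1`-chain given by a function of two variables. -/
def UFChain.ofEdge {c : G → G → ℝ} (hc : IsUFEdgeChain c) : UFChain (WordMetricSpace S hS) 1 :=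
  ⟨fun x => c (x 0) (x 1), (isUFChain_edge_iff hfin hS c).2 hc⟩

omit hfin in
/-- The coefficient function of a uniformly finite `1`-chain. -/
def UFChain.edge (c : UFChain (WordMetricSpace S hS) 1) (x y : G) : ℝ := c.1 ![x, y]

omit hfin in
theorem UFChain.edge_ext {c c' : UFChain (WordMetricSpace S hS) 1}
    (h : ∀ x y : G, c.edge hS x y = c'.edge hS x y) : c = c' := by
  refine Subtype.ext (funext fun x => ?_)
  have hx : x = ![x 0, x 1] := by ext i; fin_cases i <;> rfl
  rw [hx]
  exact h (x 0) (x 1)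

theorem UFChain.isUFEdgeChain_edge (c : UFChain (WordMetricSpace S hS) 1) :
    IsUFEdgeChain (c.edge hS) := by
  rw [← isUFChain_edge_iff hfin hS]
  refine (congrArg IsUFChain ?_).mpr c.2
  refine funext fun x => congrArg c.1 ?_
  ext i; fin_cases i <;> rfl

omit hfin in
theorem edgeBoundary_edge (c : UFChain (WordMetricSpace S hS) 1)
    (y : Fin 1 → WordMetricSpace S hS) :
    (ufBoundary (WordMetricSpace S hS) 0 c).1 y = edgeBoundary (c.edge hS) (y 0) := by
  have h : (ufBoundary (WordMetricSpace S hS) 0 c).1 y =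
      ∑ j : Fin 2, (-1 : ℝ) ^ (j : ℕ) * ufFaceFun j c.1 y := by
    simp only [ufBoundary, LinearMap.sum_apply]
    rfl
  rw [h, Fin.sum_univ_two]
  have h0 : ufFaceFun 0 c.1 y = ∑ᶠ z : G, c.edge hS z (y 0) :=
    finsum_congr fun z => congrArg c.1 (by ext i; fin_cases i <;> rfl)
  have h1 : ufFaceFun 1 c.1 y = ∑ᶠ z : G, c.edge hS (y 0) z :=
    finsum_congr fun z => congrArg c.1 (by ext i; fin_cases i <;> rfl)
  rw [h0, h1]
  simp [edgeBoundary, sub_eq_add_neg]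

omit hfin in
theorem mem_ufCycles_iff (c : UFChain (WordMetricSpace S hS) 1) :
    c ∈ ufCycles (WordMetricSpace S hS) 1 ↔ ∀ y : G, edgeBoundary (c.edge hS) y = 0 := by
  change ufBoundary (WordMetricSpace S hS) 0 c = 0 ↔ _
  constructor
  · intro h y
    rw [← edgeBoundary_edge hS c fun _ => y, h]
    rfl
  · intro h
    refine Subtype.ext (funext fun y => ?_)
    exact (edgeBoundary_edge hS c y).trans (h (y 0))

omit hfin in
theorem triangleBoundary_apply (b : UFChain (WordMetricSpace S hS) 2) (x y : G) :
    (ufBoundary (WordMetricSpace S hS) 1 b).edge hS x y =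
      triangleBoundary (fun x y z : G => b.1 ![x, y, z]) x y := by
  have h : (ufBoundary (WordMetricSpace S hS) 1 b).edge hS x y =
      ∑ j : Fin 3, (-1 : ℝ) ^ (j : ℕ) * ufFaceFun j b.1 ![x, y] := by
    simp only [UFChain.edge, ufBoundary, LinearMap.sum_apply]
    rw [Fin.sum_univ_three, Fin.sum_univ_three]
    rfl
  rw [h, Fin.sum_univ_three]
  have h0 : ufFaceFun (X := WordMetricSpace S hS) 0 b.1 ![x, y] = ∑ᶠ z : G, b.1 ![z, x, y] :=
    finsum_congr fun z => congrArg b.1 (by ext i; fin_cases i <;> rfl)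
  have h1 : ufFaceFun (X := WordMetricSpace S hS) 1 b.1 ![x, y] = ∑ᶠ z : G, b.1 ![x, z, y] :=
    finsum_congr fun z => congrArg b.1 (by ext i; fin_cases i <;> rfl)
  have h2 : ufFaceFun (X := WordMetricSpace S hS) 2 b.1 ![x, y] = ∑ᶠ z : G, b.1 ![x, y, z] :=
    finsum_congr fun z => congrArg b.1 (by ext i; fin_cases i <;> rfl)
  rw [h0, h1, h2]
  simp [triangleBoundary, sub_eq_add_neg]

theorem mem_ufBoundaries_iff (c : UFChain (WordMetricSpace S hS) 1) :
    c ∈ ufBoundaries (WordMetricSpace S hS) 1 ↔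
      ∃ b : G → G → G → ℝ, IsUFTriangleChain b ∧ c.edge hS = triangleBoundary b := by
  constructor
  · rintro ⟨b, rfl⟩
    refine ⟨fun x y z => b.1 ![x, y, z], ?_, ?_⟩
    · rw [← isUFChain_triangle_iff hfin hS]
      refine (congrArg IsUFChain ?_).mpr b.2
      refine funext fun x => congrArg b.1 ?_
      ext i; fin_cases i <;> rfl
    · ext x y
      exact triangleBoundary_apply hS b x y
  · rintro ⟨b, hb, h⟩
    refine ⟨⟨fun x => b (x 0) (x 1) (x 2), (isUFChain_triangle_iff hfin hS b).2 hb⟩, ?_⟩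
    refine UFChain.edge_ext hS fun x y => ?_
    exact (triangleBoundary_apply hS _ x y).trans (congrFun (congrFun h x) y).symm

end Chains

/-! ### From an invariant mean to asymptotically invariant weights -/

section Reiter

open Filter Topology

variable {G : Type*} [Group G]

/-- The mean of a difference of translates is zero, so such a sum cannot stay above `u > 0`
everywhere. Precomposing with inversion turns the right translations here into the left translations
under which `m` is invariant. -/
theorem IsLeftInvariantMean.exists_sum_le {m : lp (fun _ : G => ℝ) ∞ →ₗ[ℝ] ℝ}
    (hm : IsLeftInvariantMean m) {ι : Type*} [Fintype ι] (s : ι → G) (ψ : ι → G → ℝ) {M : ℝ}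
    (hψ : ∀ i x, |ψ i x| ≤ M) {u : ℝ} (hu : 0 < u) :
    ∃ x, ∑ i, (ψ i (x * s i) - ψ i x) ≤ u := by
  by_contra! h
  let χ : ι → lp (fun _ : G => ℝ) ∞ := fun i => ⟨fun y => ψ i y⁻¹, memℓp_infty_iff.2 ⟨M, by
    rintro _ ⟨x, rfl⟩
    exact hψ i _⟩⟩
  have h1 := hm.nonneg (∑ i, (leftTranslate (s i) (χ i) - χ i) - u • 1) fun y => by
    have hy : (∑ i, (leftTranslate (s i) (χ i) - χ i) - u • (1 : lp (fun _ : G => ℝ) ∞)) y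
        = ∑ i, (ψ i (y⁻¹ * s i) - ψ i y⁻¹) - u := by
      have h0 : ((∑ i, (leftTranslate (s i) (χ i) - χ i) : lp (fun _ : G => ℝ) ∞) : G → ℝ) y =
          ∑ i, (leftTranslate (s i) (χ i) - χ i : lp (fun _ : G => ℝ) ∞) y := by
        rw [lp.coeFn_sum, Finset.sum_apply]
      rw [lp.coeFn_sub, Pi.sub_apply, h0, lp.coeFn_smul, Pi.smul_apply]
      congr 1
      · refine Finset.sum_congr rfl fun i _ => ?_
        change ψ i ((s i)⁻¹ * y)⁻¹ - ψ i y⁻¹ = _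
        rw [mul_inv_rev, inv_inv]
      · simp
    rw [hy]
    exact sub_nonneg.2 (h _).le
  rw [map_sub, map_smul, hm.map_one, map_sum] at h1
  simp only [map_sub, hm.invariant, sub_self, Finset.sum_const_zero, smul_eq_mul, mul_one,
    zero_sub] at h1
  linarith

/-- This is the Day–Namioka convexity argument. If `0` were not in the norm closure of the convex
set of translation defects, Hahn–Banach would separate it by a functional, and testing that
functional on point masses contradicts `exists_sum_le`. The weights may be signed, as only their
total mass matters later. -/
theorem IsAmenableGroup.exists_almost_invariant (hG : IsAmenableGroup G) {S : Set G}
    (hS : S.Finite) {ε : ℝ} (hε : 0 < ε) :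
    ∃ p : G →₀ ℝ, (p.sum fun _ a => a) = 1 ∧ ∀ s ∈ S, ∀ β : G → ℝ, (∀ x, |β x| ≤ 1) →
      |p.sum fun x a => a * (β (x * s) - β x)| ≤ ε := by
  classical
  obtain ⟨m, hm⟩ := hG
  have := hS.fintype
  -- Smallness in the norm of the dual of `ℓ^∞` is what makes the estimate uniform in `β`.
  let E := StrongDual ℝ (lp (fun _ : G => ℝ) ∞)
  let δ : G → E := fun x => lp.evalCLM ℝ (fun _ : G => ℝ) ∞ x
  have hδ : ∀ x, ‖δ x‖ ≤ 1 := fun x =>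
    ContinuousLinearMap.opNorm_le_bound _ zero_le_one fun φ => by
      rw [one_mul]; exact lp.norm_apply_le_norm ENNReal.top_ne_zero φ x
  let L : (G →₀ ℝ) →ₗ[ℝ] (S → E) :=
    Finsupp.linearCombination ℝ fun x (s : S) => δ (x * s) - δ x
  let C : Set (S → E) := L '' {p | (p.sum fun _ a => a) = 1}
  have hC : Convex ℝ C := by
    refine Convex.linear_image ?_ L
    intro p hp q hq a b _ _ hab
    rw [Set.mem_ofPred_eq] at hp hq ⊢
    rw [Finsupp.sum_add_index' (by simp) (by simp), Finsupp.sum_smul_index (by simp),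
      Finsupp.sum_smul_index (by simp), ← Finsupp.mul_sum, ← Finsupp.mul_sum, hp, hq]
    linarith
  have h0 : (0 : S → E) ∈ closure C := by
    by_contra h0
    obtain ⟨f, u, hu, hf⟩ := geometric_hahn_banach_point_closed hC.closure isClosed_closure h0
    rw [map_zero] at hu
    let ψ : S → G → ℝ := fun s x => f (Pi.single s (δ x))
    have hψ : ∀ s x, |ψ s x| ≤ ‖f‖ := fun s x => by
      refine (f.le_opNorm _).trans (mul_le_of_le_one_right (norm_nonneg _) ?_)
      rw [Pi.norm_single]
      exact hδ x
    obtain ⟨x, hx⟩ := hm.exists_sum_le (fun s : S => (s : G)) ψ hψ hu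
    refine absurd (hf (L (Finsupp.single x 1)) (subset_closure ⟨_, by simp, rfl⟩)) (not_lt.2 ?_)
    refine le_trans (le_of_eq ?_) hx
    rw [Finsupp.linearCombination_single, one_smul,
      ← Finset.univ_sum_single (fun s : S => δ (x * s) - δ x), map_sum]
    refine Finset.sum_congr rfl fun s _ => ?_
    rw [Pi.single_sub, map_sub]
  rw [Metric.mem_closure_iff] at h0
  obtain ⟨_, ⟨p, hp, rfl⟩, hpε⟩ := h0 ε hε
  refine ⟨p, hp, fun s hs β hβ => ?_⟩
  let φ : lp (fun _ : G => ℝ) ∞ := ⟨β, memℓp_infty_iff.2 ⟨1, by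
    rintro _ ⟨x, rfl⟩
    exact hβ x⟩⟩
  have hφ : ‖φ‖ ≤ 1 := lp.norm_le_of_forall_le zero_le_one hβ
  have hLp : L p ⟨s, hs⟩ φ = p.sum fun x a => a * (β (x * s) - β x) := by
    simp only [L, Finsupp.linearCombination_apply, Finsupp.sum, Finset.sum_apply,
      sum_apply]
    rfl
  rw [← hLp, ← Real.norm_eq_abs]
  rw [dist_zero_left] at hpε
  calc ‖L p ⟨s, hs⟩ φ‖ ≤ ‖L p ⟨s, hs⟩‖ * ‖φ‖ := ContinuousLinearMap.le_opNorm _ _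
    _ ≤ ‖L p ⟨s, hs⟩‖ := mul_le_of_le_one_right (norm_nonneg _) hφ
    _ ≤ ε := (norm_le_pi_norm _ _).trans hpε.le

/-- A sequence of finitely supported functions of total mass one which is asymptotically invariant
under right translations. -/
structure IsReiterSequence (p : ℕ → G →₀ ℝ) : Prop where
  sum_eq_one : ∀ n, ((p n).sum fun _ a => a) = 1
  eventually_le : ∀ s : G, ∀ ε : ℝ, 0 < ε → ∀ᶠ n in atTop, ∀ β : G → ℝ, (∀ x, |β x| ≤ 1) →
      |(p n).sum fun x a => a * (β (x * s) - β x)| ≤ ε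

/-- Almost invariance under the generators is enough: uniformity over all `β` bounded by `1` is
preserved when `β` is translated, so the elements satisfying the estimate are closed under products
and inverses. -/
theorem IsAmenableGroup.exists_isReiterSequence (hG : IsAmenableGroup G) {S : Set G}
    (hfin : S.Finite) (hS : Subgroup.closure S = ⊤) : ∃ p : ℕ → G →₀ ℝ, IsReiterSequence p := by
  choose p hp1 hp2 using fun n : ℕ =>
    hG.exists_almost_invariant hfin (Nat.one_div_pos_of_nat (α := ℝ) (n := n))
  refine ⟨p, hp1, fun s => ?_⟩
  have hs : s ∈ Subgroup.closure S := hS ▸ Subgroup.mem_top s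
  induction hs using Subgroup.closure_induction with
  | mem s hs =>
    intro ε hε
    filter_upwards [tendsto_one_div_add_atTop_nhds_zero_nat.eventually_le_const hε] with n hn β hβ
    exact (hp2 n s hs β hβ).trans hn
  | one => exact fun ε hε => Eventually.of_forall fun n β _ => by simpa using hε.le
  | mul s t _ _ ihs iht =>
    intro ε hε
    filter_upwards [ihs (ε / 2) (half_pos hε), iht (ε / 2) (half_pos hε)] with n h1 h2 β hβ
    have h3 := (abs_add_le _ _).trans
      (add_le_add (h1 (fun x => β (x * t)) fun x => hβ _) (h2 β hβ))
    rw [add_halves, ← Finsupp.sum_add] at h3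
    refine le_trans (le_of_eq ?_) h3
    congr 1
    refine Finsupp.sum_congr fun x _ => ?_
    rw [mul_assoc]
    ring
  | inv s _ ih =>
    intro ε hε
    filter_upwards [ih ε hε] with n h β hβ
    refine le_trans (le_of_eq ?_) (h (fun x => β (x * s⁻¹)) fun x => hβ _)
    rw [← abs_neg, ← Finsupp.sum_neg]
    congr 1
    refine Finsupp.sum_congr fun x _ => ?_
    simp only [mul_inv_cancel_right]
    ring

end Reiter

/-! ### Averaging a homomorphism over the edges of a chain -/

section Pairing

open Filter Topology

variable {G : Type*} [Group G]

theorem finsum_eq_sum_mul_left {U : Finset G} {f : G → ℝ} (x : G)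
    (h : ∀ z, f z ≠ 0 → x⁻¹ * z ∈ U) : ∑ᶠ z, f z = ∑ s ∈ U, f (x * s) := by
  rw [← finsum_comp_equiv (Equiv.mulLeft x) (f := f)]
  refine finsum_eq_sum_of_support_subset _ fun s hs => ?_
  simpa using h _ hs

theorem finsum_eq_sum_mul_inv {U : Finset G} {f : G → ℝ} (x : G)
    (h : ∀ z, f z ≠ 0 → z⁻¹ * x ∈ U) : ∑ᶠ z, f z = ∑ s ∈ U, f (x * s⁻¹) := by
  rw [← finsum_comp_equiv ((Equiv.inv G).trans (Equiv.mulLeft x)) (f := f)]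
  refine finsum_eq_sum_of_support_subset _ fun s hs => ?_
  simpa using h _ hs

theorem IsUFTriangleChain.exists_controlled {b : G → G → G → ℝ} (hb : IsUFTriangleChain b) :
    ∃ U : Finset G, ∀ x y z, b x y z ≠ 0 → x⁻¹ * y ∈ U ∧ x⁻¹ * z ∈ U ∧ y⁻¹ * z ∈ U := by
  classical
  obtain ⟨T, hT⟩ := hb.controlled
  refine ⟨T ∪ Finset.image₂ (fun s t => s⁻¹ * t) T T, fun x y z h => ?_⟩
  obtain ⟨h1, h2⟩ := hT x y z h
  refine ⟨Finset.mem_union_left _ h1, Finset.mem_union_left _ h2, Finset.mem_union_right _ ?_⟩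
  exact Finset.mem_image₂.2 ⟨_, h1, _, h2, by group⟩

/-- Evaluating a homomorphism on the edges of a boundary gives a sum of functions of the form
`β(x s⁻¹) - β(x)`. -/
theorem finsum_mul_triangleBoundary {φ : G → ℝ} (hφ : ∀ x y, φ (x * y) = φ x + φ y)
    {b : G → G → G → ℝ} {U : Finset G}
    (hU : ∀ x y z, b x y z ≠ 0 → x⁻¹ * y ∈ U ∧ x⁻¹ * z ∈ U ∧ y⁻¹ * z ∈ U) (x : G) :
    ∑ᶠ y, φ (x⁻¹ * y) * triangleBoundary b x y = ∑ s ∈ U, ∑ t ∈ U,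
      φ t * (b (x * s⁻¹) (x * s⁻¹ * s) (x * s⁻¹ * s * t) - b x (x * s) (x * s * t)) := by
  have h1 : ∀ y, ∑ᶠ z, b z x y = ∑ s ∈ U, b (x * s⁻¹) x y := fun y =>
    finsum_eq_sum_mul_inv x fun z hz => (hU _ _ _ hz).1
  have h2 : ∀ y, ∑ᶠ z, b x z y = ∑ s ∈ U, b x (x * s) y := fun y =>
    finsum_eq_sum_mul_left x fun z hz => (hU _ _ _ hz).1
  have h3 : ∀ y, ∑ᶠ z, b x y z = ∑ t ∈ U, b x y (y * t) := fun y =>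
    finsum_eq_sum_mul_left y fun z hz => (hU _ _ _ hz).2.2
  -- The third vertex is parametrized once from `x` and once from `xs`. Then `φ (s * t)` splits, and
  -- its `φ s` part cancels against the third face.
  have hsub : ∀ s, ∑ t ∈ U, φ t * b x (x * s) (x * t) =
      ∑ t ∈ U, φ (s * t) * b x (x * s) (x * s * t) := by
    intro s
    have e1 := finsum_eq_sum_mul_left (U := U) (f := fun z => φ (x⁻¹ * z) * b x (x * s) z) x
      fun z hz => (hU _ _ _ (right_ne_zero_of_mul hz)).2.1
    have e2 := finsum_eq_sum_mul_left (U := U) (f := fun z => φ (x⁻¹ * z) * b x (x * s) z) (x * s)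
      fun z hz => (hU _ _ _ (right_ne_zero_of_mul hz)).2.2
    simpa [mul_assoc] using e1.symm.trans e2
  have h4 : ∑ᶠ y, φ (x⁻¹ * y) * triangleBoundary b x y =
      ∑ s ∈ U, φ s * triangleBoundary b x (x * s) := by
    rw [finsum_eq_sum_mul_left (U := U) x]
    · simp
    · intro y hy
      have hy := right_ne_zero_of_mul hy
      contrapose! hy
      have e1 : ∀ z, b z x y = 0 := fun z => by
        by_contra h
        exact hy (hU _ _ _ h).2.2
      have e2 : ∀ z, b x z y = 0 := fun z => by
        by_contra h
        exact hy (hU _ _ _ h).2.1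
      have e3 : ∀ z, b x y z = 0 := fun z => by
        by_contra h
        exact hy (hU _ _ _ h).1
      simp [triangleBoundary, e1, e2, e3]
  rw [h4]
  simp only [triangleBoundary, h1, h2, h3, mul_add, mul_sub, Finset.sum_add_distrib,
    Finset.sum_sub_distrib, Finset.mul_sum, inv_mul_cancel_right]
  rw [Finset.sum_comm (f := fun s t => φ s * b (x * t⁻¹) x (x * s)),
    Finset.sum_comm (f := fun s t => φ s * b x (x * t) (x * s)),
    Finset.sum_congr rfl fun s _ => hsub s]
  simp only [hφ, add_mul, Finset.sum_add_distrib]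
  ring

theorem IsReiterSequence.tendsto_sub {p : ℕ → G →₀ ℝ} (hp : IsReiterSequence p) (s : G)
    {β : G → ℝ} {M : ℝ} (hβ : ∀ x, |β x| ≤ M) :
    Tendsto (fun n => (p n).sum fun x a => a * (β (x * s) - β x)) atTop (𝓝 0) := by
  -- Rescaling by `M + 1` instead of `M` avoids division by zero.
  have hM : 0 < M + 1 := by linarith [(abs_nonneg _).trans (hβ 1)]
  rw [Metric.tendsto_nhds]
  intro ε hε
  filter_upwards [hp.eventually_le s (ε / 2 / (M + 1)) (by positivity)] with n hn
  have h := hn (fun x => β x / (M + 1)) fun x => by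
    rw [abs_div, abs_of_pos hM, div_le_one hM]
    linarith [hβ x]
  have h' : ((p n).sum fun x a => a * (β (x * s) / (M + 1) - β x / (M + 1))) =
      ((p n).sum fun x a => a * (β (x * s) - β x)) / (M + 1) := by
    rw [Finsupp.sum, Finsupp.sum, Finset.sum_div]
    exact Finset.sum_congr rfl fun x _ => by ring
  rw [h', abs_div, abs_of_pos hM, div_le_div_iff_of_pos_right hM] at h
  rw [Real.dist_0_eq_abs]
  linarith

theorem IsReiterSequence.tendsto_triangleBoundary {p : ℕ → G →₀ ℝ} (hp : IsReiterSequence p)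
    {φ : G → ℝ} (hφ : ∀ x y, φ (x * y) = φ x + φ y) {b : G → G → G → ℝ}
    (hb : IsUFTriangleChain b) :
    Tendsto (fun n => (p n).sum fun x a => a * ∑ᶠ y, φ (x⁻¹ * y) * triangleBoundary b x y)
      atTop (𝓝 0) := by
  obtain ⟨U, hU⟩ := hb.exists_controlled
  obtain ⟨M, hM⟩ := hb.bounded
  have h : ∀ n, ((p n).sum fun x a => a * ∑ᶠ y, φ (x⁻¹ * y) * triangleBoundary b x y) =
      ∑ s ∈ U, ∑ t ∈ U, φ t * (p n).sum fun x a => a *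
        (b (x * s⁻¹) (x * s⁻¹ * s) (x * s⁻¹ * s * t) - b x (x * s) (x * s * t)) := by
    intro n
    simp only [finsum_mul_triangleBoundary hφ hU, Finsupp.sum, Finset.mul_sum]
    rw [Finset.sum_comm]
    refine Finset.sum_congr rfl fun s _ => ?_
    rw [Finset.sum_comm]
    exact Finset.sum_congr rfl fun t _ => Finset.sum_congr rfl fun x _ => by ring
  simp only [h]
  rw [show (0 : ℝ) = ∑ s ∈ U, ∑ t ∈ U, φ t * 0 by simp]
  exact tendsto_finsetSum _ fun s _ => tendsto_finsetSum _ fun t _ =>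
    (hp.tendsto_sub s⁻¹ (β := fun x => b x (x * s) (x * s * t)) fun x => hM _ _ _).const_mul _

/-- Left translations commute with the right translations in the definition, so each member may be
moved by its own element; this is the freedom used to separate the supports. -/
theorem IsReiterSequence.translate {p : ℕ → G →₀ ℝ} (hp : IsReiterSequence p) {k : ℕ → ℕ}
    (hk : StrictMono k) (a : ℕ → G) :
    IsReiterSequence fun n => (p (k n)).mapDomain fun x => a n * x := by
  refine ⟨fun n => ?_, fun s ε hε => ?_⟩
  · rw [Finsupp.sum_mapDomain_index (by simp) (by simp)]
    exact hp.sum_eq_one _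
  · filter_upwards [hk.tendsto_atTop.eventually (hp.eventually_le s ε hε)] with n hn β hβ
    rw [Finsupp.sum_mapDomain_index (by simp) fun _ _ _ => by ring]
    simpa only [mul_assoc] using hn (fun x => β (a n * x)) fun x => hβ _

/-- The chain `∑ₓ f(x) · (x, xg)`. -/
noncomputable def flowChain (g : G) (f : G → ℝ) (x y : G) : ℝ :=
  open Classical in if y = x * g then f x else 0

theorem isUFEdgeChain_flowChain (g : G) {f : G → ℝ} {M : ℝ} (hf : ∀ x, |f x| ≤ M) :
    IsUFEdgeChain (flowChain g f) := by
  refine ⟨⟨M, fun x y => ?_⟩, {g}, fun x y h => ?_⟩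
  · rw [flowChain]
    split_ifs
    · exact hf x
    · simpa using (abs_nonneg _).trans (hf x)
  · have : y = x * g := by
      by_contra h'
      exact h (by simp [flowChain, h'])
    simp [this]

theorem finsum_mul_flowChain (w : G → ℝ) (g : G) (f : G → ℝ) (x : G) :
    ∑ᶠ y, w y * flowChain g f x y = w (x * g) * f x := by
  rw [finsum_eq_single _ (x * g) fun y hy => by simp [flowChain, hy]]
  simp [flowChain]

theorem edgeBoundary_flowChain {g : G} {f : G → ℝ} (hf : ∀ x, f (x * g) = f x) (y : G) :
    edgeBoundary (flowChain g f) y = 0 := by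
  have h1 : ∑ᶠ z, flowChain g f z y = f (y * g⁻¹) := by
    rw [finsum_eq_single _ (y * g⁻¹)]
    · simp [flowChain]
    · intro z hz
      rw [flowChain, if_neg]
      rintro rfl
      exact hz (by simp)
  have h2 := finsum_mul_flowChain (fun _ => 1) g f y
  simp only [one_mul] at h2
  rw [edgeBoundary, h1, h2, ← hf (y * g⁻¹), inv_mul_cancel_right, sub_self]

/-- If `∑ₓ f(x) · (x, xg)` bounds and `φ(g) ≠ 0`, then the averages of `f` tend to zero. -/
theorem IsReiterSequence.tendsto_of_flowChain_eq {p : ℕ → G →₀ ℝ} (hp : IsReiterSequence p)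
    {φ : G → ℝ} (hφ : ∀ x y, φ (x * y) = φ x + φ y) {g : G} (hg : φ g ≠ 0) {f : G → ℝ}
    {b : G → G → G → ℝ} (hb : IsUFTriangleChain b) (h : flowChain g f = triangleBoundary b) :
    Tendsto (fun n => (p n).sum fun x a => a * f x) atTop (𝓝 0) := by
  have h1 := (hp.tendsto_triangleBoundary hφ hb).const_mul (φ g)⁻¹
  rw [mul_zero] at h1
  refine h1.congr fun n => ?_
  rw [Finsupp.mul_sum]
  refine Finsupp.sum_congr fun x _ => ?_
  rw [← h, finsum_mul_flowChain (fun y => φ (x⁻¹ * y)), inv_mul_cancel_left]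
  field_simp

end Pairing

/-! ### Infinitely many independent classes when `⟨g⟩` has infinite index -/

section InfiniteDimensional

open Filter Topology

variable {G : Type*} [Group G]

/-- A consequence of B. H. Neumann's lemma: finitely many left cosets of a subgroup of infinite
index can be moved away from finitely many others. -/
theorem Subgroup.exists_forall_inv_mul_notMem {H : Subgroup G} (hH : ¬ H.FiniteIndex)
    (P Q : Finset G) : ∃ a : G, ∀ x ∈ P, ∀ y ∈ Q, (a * x)⁻¹ * y ∉ H := by
  by_contra! h
  -- Otherwise each `a` lies in some `yHx⁻¹ = yx⁻¹ · xHx⁻¹`, so finitely many cosets of conjugates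
  -- of `H` cover `G`, and one of these conjugates has finite index.
  obtain ⟨⟨x, y⟩, -, hk⟩ := Subgroup.exists_finiteIndex_of_leftCoset_cover
    (s := P ×ˢ Q) (H := fun i : G × G => H.map (MulAut.conj i.1).toMonoidHom)
    (g := fun i : G × G => i.2 * i.1⁻¹) (by
      refine Set.eq_univ_of_forall fun a => ?_
      obtain ⟨x, hx, y, hy, hxy⟩ := h a
      refine Set.mem_iUnion₂.2 ⟨(x, y), Finset.mem_product.2 ⟨hx, hy⟩, ?_⟩
      refine Set.mem_smul_set.2 ⟨x * ((a * x)⁻¹ * y)⁻¹ * x⁻¹,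
        ⟨_, H.inv_mem hxy, rfl⟩, ?_⟩
      simp only [smul_eq_mul]
      group)
  refine hH ⟨?_⟩
  have := hk.index_ne_zero
  rwa [MulEquiv.toMonoidHom_eq_coe, Subgroup.index_map_equiv] at this

theorem Subgroup.exists_seq_forall_inv_mul_notMem {H : Subgroup G} (hH : ¬ H.FiniteIndex)
    (P : ℕ → Finset G) : ∃ k : ℕ → ℕ, StrictMono k ∧ ∃ a : ℕ → G, ∀ m n, m < n →
      ∀ x ∈ P (k m), ∀ y ∈ P (k n), (a m * x)⁻¹ * (a n * y) ∉ H := by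
  classical
  obtain ⟨f, -, hf⟩ := exists_seq_of_forall_finset_exists (α := ℕ × G) (fun _ => True)
    (fun i j => i.1 < j.1 ∧ ∀ x ∈ P i.1, ∀ y ∈ P j.1, (i.2 * x)⁻¹ * (j.2 * y) ∉ H) (by
      intro s _
      -- The index exceeds all earlier ones, and `a` moves the new set away from all sets already
      -- placed.
      obtain ⟨a, ha⟩ := H.exists_forall_inv_mul_notMem hH (P (s.sup Prod.fst + 1))
        (s.biUnion fun i => (P i.1).image (i.2 * ·))
      refine ⟨(s.sup Prod.fst + 1, a), trivial, fun i hi =>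
        ⟨Nat.lt_succ_of_le (Finset.le_sup (f := Prod.fst) hi), fun x hx y hy h => ?_⟩⟩
      refine ha y hy (i.2 * x)
        (Finset.mem_biUnion.2 ⟨i, hi, Finset.mem_image_of_mem _ hx⟩) ?_
      have := H.inv_mem h
      rwa [mul_inv_rev, inv_inv] at this)
  exact ⟨fun n => (f n).1, fun m n h => (hf m n h).1, fun n => (f n).2,
    fun m n h => (hf m n h).2⟩

theorem IsReiterSequence.exists_disjoint {p : ℕ → G →₀ ℝ} (hp : IsReiterSequence p)
    {H : Subgroup G} (hH : ¬ H.FiniteIndex) :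
    ∃ q : ℕ → G →₀ ℝ, IsReiterSequence q ∧
      ∀ m n, m ≠ n → ∀ x ∈ (q m).support, ∀ y ∈ (q n).support, x⁻¹ * y ∉ H := by
  classical
  obtain ⟨k, hk, a, ha⟩ := H.exists_seq_forall_inv_mul_notMem hH fun n => (p n).support
  have hlt : ∀ m n, m < n → ∀ x ∈ ((p (k m)).mapDomain (a m * ·)).support,
      ∀ y ∈ ((p (k n)).mapDomain (a n * ·)).support, x⁻¹ * y ∉ H := by
    intro m n hmn x hx y hy
    obtain ⟨x, hx', rfl⟩ := Finset.mem_image.1 (Finsupp.mapDomain_support hx)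
    obtain ⟨y, hy', rfl⟩ := Finset.mem_image.1 (Finsupp.mapDomain_support hy)
    exact ha m n hmn x hx' y hy'
  refine ⟨_, hp.translate hk a, fun m n hmn x hx y hy => ?_⟩
  rcases hmn.lt_or_gt with h | h
  · exact hlt m n h x hx y hy
  · intro hxy
    have := H.inv_mem hxy
    rw [mul_inv_rev, inv_inv] at this
    exact hlt n m h y hy x hx this

/-- The indicator function of the `H`-cosets meeting the support of some `q n`
with `n.unpair.1 = i`. -/
noncomputable def cosetIndicator (H : Subgroup G) (q : ℕ → G →₀ ℝ) (i : ℕ) (x : G) : ℝ :=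
  open Classical in if ∃ n, n.unpair.1 = i ∧ ∃ y ∈ (q n).support, y⁻¹ * x ∈ H then 1 else 0

theorem abs_cosetIndicator_le (H : Subgroup G) (q : ℕ → G →₀ ℝ) (i : ℕ) (x : G) :
    |cosetIndicator H q i x| ≤ 1 := by
  rw [cosetIndicator]
  split_ifs <;> simp

theorem cosetIndicator_mul (H : Subgroup G) (q : ℕ → G →₀ ℝ) (i : ℕ) (x : G) {g : G}
    (hg : g ∈ H) : cosetIndicator H q i (x * g) = cosetIndicator H q i x := by
  have h : ∀ y, y⁻¹ * (x * g) ∈ H ↔ y⁻¹ * x ∈ H := fun y => by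
    rw [← mul_assoc, H.mul_mem_cancel_right hg]
  rw [cosetIndicator, cosetIndicator]
  congr 1
  simp only [h]

theorem cosetIndicator_of_mem_support {H : Subgroup G} {q : ℕ → G →₀ ℝ}
    (hq : ∀ m n, m ≠ n → ∀ x ∈ (q m).support, ∀ y ∈ (q n).support, x⁻¹ * y ∉ H) (i n : ℕ) {x : G}
    (hx : x ∈ (q n).support) : cosetIndicator H q i x = if n.unpair.1 = i then 1 else 0 := by
  rw [cosetIndicator]
  congr 1
  refine propext ⟨?_, fun h => ⟨n, h, x, hx, by simp⟩⟩
  rintro ⟨m, h, y, hy, hyx⟩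
  by_cases hmn : m = n
  · exact hmn ▸ h
  · exact absurd hyx (hq m n hmn y hy x hx)

variable {S : Set G} (hfin : S.Finite) (hS : Subgroup.closure S = ⊤)

/-- A coefficient of a uniformly finite `1`-chain as a linear functional. -/
def UFChain.edgeHom (x y : G) : UFChain (WordMetricSpace S hS) 1 →ₗ[ℝ] ℝ where
  toFun c := c.edge hS x y
  map_add' _ _ := rfl
  map_smul' _ _ := rfl

/-- The cycle `∑ₓ f(x) · (x, xg)` for a bounded function `f` invariant under `g`. -/
noncomputable def flowCycle {g : G} {f : G → ℝ} {M : ℝ} (hM : ∀ x, |f x| ≤ M)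
    (hf : ∀ x, f (x * g) = f x) : ufCycles (WordMetricSpace S hS) 1 :=
  ⟨UFChain.ofEdge hfin hS (isUFEdgeChain_flowChain g hM),
    (mem_ufCycles_iff hS _).2 (edgeBoundary_flowChain hf)⟩

include hfin in
theorem mem_submoduleOf_ufBoundaries_iff (c : ufCycles (WordMetricSpace S hS) 1) :
    c ∈ (ufBoundaries (WordMetricSpace S hS) 1).submoduleOf (ufCycles (WordMetricSpace S hS) 1) ↔
      ∃ b : G → G → G → ℝ, IsUFTriangleChain b ∧ c.1.edge hS = triangleBoundary b :=
  mem_ufBoundaries_iff hfin hS c.1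

include hfin in
theorem not_finite_ufHomology_one (hG : IsAmenableGroup G) {φ : G → ℝ}
    (hφ : ∀ x y, φ (x * y) = φ x + φ y) {g : G} (hg : φ g ≠ 0)
    (hH : ¬ (Subgroup.zpowers g).FiniteIndex) :
    ¬ Module.Finite ℝ (UFHomology (WordMetricSpace S hS) 1) := by
  intro hfinite
  obtain ⟨p, hp⟩ := hG.exists_isReiterSequence hfin hS
  obtain ⟨q, hq, hdisj⟩ := hp.exists_disjoint hH
  let z : ℕ → ufCycles (WordMetricSpace S hS) 1 := fun i =>
    flowCycle hfin hS (abs_cosetIndicator_le (Subgroup.zpowers g) q i)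
      fun x => cosetIndicator_mul _ q i x (Subgroup.mem_zpowers g)
  refine Module.Finite.not_linearIndependent_of_infinite (R := ℝ)
    (fun i => Submodule.mkQ ((ufBoundaries (WordMetricSpace S hS) 1).submoduleOf
      (ufCycles (WordMetricSpace S hS) 1)) (z i)) ?_
  rw [linearIndependent_iff']
  intro s t h i hi
  simp only [← map_smul, ← map_sum] at h
  rw [Submodule.mkQ_apply, Submodule.Quotient.mk_eq_zero,
    mem_submoduleOf_ufBoundaries_iff hfin hS] at h
  obtain ⟨b, hb, h⟩ := h
  have hedge : flowChain g (fun x => ∑ j ∈ s, t j * cosetIndicator (Subgroup.zpowers g) q j x) =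
      triangleBoundary b := by
    rw [← h]
    ext x y
    rw [show UFChain.edge hS (∑ j ∈ s, t j • z j).1 x y =
      (UFChain.edgeHom hS x y ∘ₗ Submodule.subtype _) (∑ j ∈ s, t j • z j) from rfl, map_sum]
    simp only [map_smul]
    rw [flowChain, Finset.sum_congr rfl fun j _ =>
      show t j • (UFChain.edgeHom hS x y ∘ₗ Submodule.subtype _) (z j) =
        t j * flowChain g (cosetIndicator (Subgroup.zpowers g) q j) x y from rfl]
    by_cases hxy : y = x * g <;> simp [flowChain, hxy]
  have hlim := hq.tendsto_of_flowChain_eq hφ hg hb hedge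
  -- The indices `Nat.pair i j` run through the `i`-th class. On the supports of these `q` the
  -- combination is constantly `t i`, so its averages equal `t i`, while they must tend to zero.
  have hpair : Tendsto (fun j => Nat.pair i j) atTop atTop :=
    tendsto_atTop_mono (fun j => Nat.right_le_pair i j) tendsto_id
  refine tendsto_nhds_unique ((hlim.comp hpair).congr fun j => ?_) tendsto_const_nhds |>.symm
  have hval : ∀ x ∈ (q (Nat.pair i j)).support,
      ∑ l ∈ s, t l * cosetIndicator (Subgroup.zpowers g) q l x = t i := by
    intro x hx
    simp [cosetIndicator_of_mem_support hdisj _ _ hx, hi]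
  rw [Function.comp_apply, Finsupp.sum_congr (g2 := fun _ a => t i * a) fun x hx => by
    rw [hval x hx, mul_comm], ← Finsupp.mul_sum, hq.sum_eq_one, mul_one]

end InfiniteDimensional

/-! ### Flux and filling of cycles on a coarse line -/

section CoarseLine

variable {G : Type*} [Group G]

/-- `N : G → ℤ` and `e : ℤ → G` are coarsely inverse to each other. -/
structure IsCoarseLine (N : G → ℤ) (e : ℤ → G) : Prop where
  section_apply : ∀ n, N (e n) = n
  lipschitz : ∀ T : Finset G, ∃ C : ℤ, ∀ x y, x⁻¹ * y ∈ T → |N y - N x| ≤ C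
  proper : ∀ C : ℤ, ∃ T : Finset G, ∀ n x, |N x - n| ≤ C → (e n)⁻¹ * x ∈ T

theorem IsUFEdgeChain.finite_support_left {c : G → G → ℝ} (hc : IsUFEdgeChain c) (y : G)
    (w : G → ℝ) : (Function.support fun x => c x y * w x).Finite := by
  obtain ⟨T, hT⟩ := hc.controlled
  refine (T.finite_toSet.image fun s => y * s⁻¹).subset fun x hx => ?_
  exact ⟨x⁻¹ * y, hT _ _ (left_ne_zero_of_mul hx), by group⟩

theorem IsUFEdgeChain.finite_support_right {c : G → G → ℝ} (hc : IsUFEdgeChain c) (x : G)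
    (w : G → ℝ) : (Function.support fun y => c x y * w y).Finite := by
  obtain ⟨T, hT⟩ := hc.controlled
  refine (T.finite_toSet.image fun s => x * s).subset fun y hy => ?_
  exact ⟨x⁻¹ * y, hT _ _ (left_ne_zero_of_mul hy), by group⟩

/-- The indicator function of `{x | N x < n}`. -/
noncomputable def belowIndicator (N : G → ℤ) (n : ℤ) (x : G) : ℝ := if N x < n then 1 else 0

/-- The indicator function of `{x | N x = n}`. -/
noncomputable def levelIndicator (N : G → ℤ) (n : ℤ) (x : G) : ℝ := if N x = n then 1 else 0

omit [Group G] in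
theorem belowIndicator_add_one (N : G → ℤ) (n : ℤ) (x : G) :
    belowIndicator N (n + 1) x = belowIndicator N n x + levelIndicator N n x := by
  simp only [belowIndicator, levelIndicator]
  rcases lt_trichotomy (N x) n with h | h | h
  · rw [if_pos (by omega), if_pos h, if_neg (by omega), add_zero]
  · rw [if_pos (by omega), if_neg (by omega), if_pos h, zero_add]
  · rw [if_neg (by omega), if_neg (by omega), if_neg (by omega), add_zero]

/-- The contribution of the edges ending in `y` to the flow of `c` across the cut
`{x | N x < n}`. -/
noncomputable def crossing (N : G → ℤ) (c : G → G → ℝ) (n : ℤ) (y : G) : ℝ :=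
  ∑ᶠ x, c x y * (belowIndicator N n x - belowIndicator N n y)

/-- The total flow of `c` across the cut `{x | N x < n}`. -/
noncomputable def flux (N : G → ℤ) (c : G → G → ℝ) (n : ℤ) : ℝ := ∑ᶠ y, crossing N c n y

section

variable {N : G → ℤ} {e : ℤ → G} (hN : IsCoarseLine N e) {c : G → G → ℝ} (hc : IsUFEdgeChain c)
include hN hc

/-- Only edges with endpoints on both sides of the cut contribute, and along an edge of `c` the
level changes by a bounded amount. -/
theorem IsCoarseLine.exists_abs_sub_le_of_crossing_ne_zero :
    ∃ C : ℤ, ∀ n y, crossing N c n y ≠ 0 → |N y - n| ≤ C := by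
  obtain ⟨T, hT⟩ := hc.controlled
  obtain ⟨C, hC⟩ := hN.lipschitz T
  refine ⟨C, fun n y h => ?_⟩
  by_contra hlt
  refine h (finsum_eq_zero_of_forall_eq_zero fun x => ?_)
  by_contra hx
  have h1 := abs_le.1 (hC x y (hT x y (left_ne_zero_of_mul hx)))
  have h2 := right_ne_zero_of_mul hx
  rw [abs_le] at hlt
  simp only [belowIndicator] at h2
  split_ifs at h2
  · simp at h2
  · omega
  · omega
  · simp at h2

theorem IsCoarseLine.finite_support_crossing (n : ℤ) :
    (Function.support (crossing N c n)).Finite := by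
  obtain ⟨C, hC⟩ := hN.exists_abs_sub_le_of_crossing_ne_zero hc
  obtain ⟨T, hT⟩ := hN.proper C
  refine (T.finite_toSet.image fun s => e n * s).subset fun y hy => ?_
  exact ⟨(e n)⁻¹ * y, hT _ _ (hC n y hy), by group⟩

omit hN in
theorem IsUFEdgeChain.exists_abs_crossing_le :
    ∃ M : ℝ, ∀ n y, |crossing N c n y| ≤ M := by
  obtain ⟨T, hT⟩ := hc.controlled
  obtain ⟨M, hM⟩ := hc.bounded
  refine ⟨∑ _s ∈ T, M, fun n y => ?_⟩
  rw [crossing, finsum_eq_sum_mul_inv y fun z hz => hT _ _ (left_ne_zero_of_mul hz)]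
  refine (Finset.abs_sum_le_sum_abs _ _).trans (Finset.sum_le_sum fun s _ => ?_)
  rw [abs_mul]
  refine (mul_le_of_le_one_right (abs_nonneg _) ?_).trans (hM _ _)
  simp only [belowIndicator]
  split_ifs <;> simp

variable (hcyc : ∀ y, edgeBoundary c y = 0)
include hcyc

omit hN in
-- Moving the cut past level `n` changes the terms by `levelIndicator`; the cycle condition then
-- trades the inflow at `y` for its outflow.
theorem crossing_add_one (n : ℤ) (y : G) : crossing N c (n + 1) y = crossing N c n y +
    (∑ᶠ x, c x y * levelIndicator N n x - levelIndicator N n y * ∑ᶠ x, c y x) := by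
  rw [← sub_eq_zero.1 (hcyc y), mul_finsum, ← finsum_sub_distrib (hc.finite_support_left y _),
    crossing, crossing, ← finsum_add_distrib (hc.finite_support_left y _)]
  · refine finsum_congr fun x => ?_
    rw [belowIndicator_add_one, belowIndicator_add_one]
    ring
  · refine (hc.finite_support_left y fun x => levelIndicator N n x - levelIndicator N n y).subset ?_
    refine Function.support_subset_iff'.2 fun x hx => ?_
    rw [Function.notMem_support] at hx
    rw [← hx]
    ring
  · refine (hc.finite_support_left y fun x => levelIndicator N n y).subset ?_
    simp_rw [mul_comm]
    rfl

/-- Summed over `y`, both correction terms in `crossing_add_one` count the finitely many edges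
starting at level `n`, so they cancel. -/
theorem IsCoarseLine.flux_add_one (n : ℤ) : flux N c (n + 1) = flux N c n := by
  obtain ⟨T, hT⟩ := hc.controlled
  obtain ⟨W, hW⟩ := hN.proper 0
  have hfin : (Function.support fun p : G × G => c p.1 p.2 * levelIndicator N n p.1).Finite := by
    refine ((W.finite_toSet.prod T.finite_toSet).image
      fun p => (e n * p.1, e n * p.1 * p.2)).subset ?_
    rintro ⟨x, y⟩ h
    have h1 : N x = n := by
      by_contra h'
      exact h (by simp [levelIndicator, h'])
    exact ⟨((e n)⁻¹ * x, x⁻¹ * y), ⟨hW _ _ (by simp [h1]), hT _ _ (left_ne_zero_of_mul h)⟩,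
      by simp⟩
  have hfin' : (Function.support fun p : G × G => c p.2 p.1 * levelIndicator N n p.2).Finite := by
    refine (hfin.image Prod.swap).subset ?_
    rintro ⟨x, y⟩ h
    exact ⟨(y, x), h, rfl⟩
  have hs1 : (Function.support fun y => ∑ᶠ x, c x y * levelIndicator N n x).Finite := by
    refine (hfin'.image Prod.fst).subset fun y hy => ?_
    obtain ⟨x, hx⟩ : ∃ x, c x y * levelIndicator N n x ≠ 0 := by
      by_contra! h
      exact hy (finsum_eq_zero_of_forall_eq_zero h)
    exact ⟨(y, x), hx, rfl⟩
  have hs2 : (Function.support fun y => levelIndicator N n y * ∑ᶠ x, c y x).Finite := by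
    refine (hfin.image Prod.fst).subset fun y hy => ?_
    rw [Function.mem_support, mul_finsum] at hy
    obtain ⟨x, hx⟩ : ∃ x, levelIndicator N n y * c y x ≠ 0 := by
      by_contra! h
      exact hy (finsum_eq_zero_of_forall_eq_zero h)
    exact ⟨(y, x), by rwa [Function.mem_support, mul_comm], rfl⟩
  have hsum : ∑ᶠ y, ∑ᶠ x, c x y * levelIndicator N n x =
      ∑ᶠ y, levelIndicator N n y * ∑ᶠ x, c y x := by
    rw [← finsum_curry (fun p : G × G => c p.2 p.1 * levelIndicator N n p.2) hfin',
      ← finsum_comp_equiv (Equiv.prodComm G G)]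
    refine (finsum_curry (fun p : G × G => c p.1 p.2 * levelIndicator N n p.1) hfin).trans ?_
    refine finsum_congr fun y => ?_
    rw [mul_finsum]
    exact finsum_congr fun x => mul_comm _ _
  rw [flux, finsum_congr (crossing_add_one hc hcyc n),
    finsum_add_distrib (hN.finite_support_crossing hc n), finsum_sub_distrib hs1 hs2, hsum,
    sub_self, add_zero, flux]
  refine (hs1.union hs2).subset fun y hy => ?_
  by_contra h
  rw [Set.mem_union, not_or, Function.notMem_support, Function.notMem_support] at h
  exact hy (by beta_reduce; rw [h.1, h.2, sub_zero])

theorem IsCoarseLine.flux_eq (n : ℤ) : flux N c n = flux N c 0 := by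
  induction n with
  | zero => rfl
  | succ n ih => rw [hN.flux_add_one hc hcyc, ih]
  | pred n ih => rw [← ih, ← hN.flux_add_one hc hcyc, sub_add_cancel]

end

/-- The part of `c` starting at level `n`, closed up to a cycle by cones over the cuts. -/
noncomputable def closedSlab (N : G → ℤ) (e : ℤ → G) (c : G → G → ℝ) (n : ℤ) (x y : G) : ℝ :=
  open Classical in c x y * levelIndicator N n x + (if x = e n then crossing N c n y else 0) -
    (if x = e (n + 1) then crossing N c (n + 1) y else 0)

/-- The sum over `n` of the cones over the closed slabs, with cone points `e n`. -/
noncomputable def slabCone (N : G → ℤ) (e : ℤ → G) (c : G → G → ℝ) (p x y : G) : ℝ :=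
  open Classical in if p = e (N p) then closedSlab N e c (N p) x y else 0

section

variable {N : G → ℤ} {e : ℤ → G} (hN : IsCoarseLine N e) {c : G → G → ℝ} (hc : IsUFEdgeChain c)
include hN hc

theorem IsCoarseLine.isUFTriangleChain_slabCone : IsUFTriangleChain (slabCone N e c) := by
  classical
  obtain ⟨T, hT⟩ := hc.controlled
  obtain ⟨C₁, hC₁⟩ := hN.lipschitz T
  obtain ⟨C₂, hC₂⟩ := hN.exists_abs_sub_le_of_crossing_ne_zero hc
  -- Edges of `c` contribute `C₁`, crossings contribute `C₂`, and the cone point `e (n + 1)` lies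
  -- one level above `n`.
  obtain ⟨U, hU⟩ := hN.proper (|C₁| + |C₂| + 1)
  obtain ⟨M, hM⟩ := hc.bounded
  obtain ⟨M', hM'⟩ := hc.exists_abs_crossing_le (N := N)
  have hM0 : 0 ≤ M := (abs_nonneg _).trans (hM 1 1)
  have hM0' : 0 ≤ M' := (abs_nonneg _).trans (hM' 0 1)
  constructor
  · refine ⟨M + M' + M', fun p x y => ?_⟩
    rw [slabCone]
    split_ifs
    · refine (abs_sub _ _).trans (add_le_add ((abs_add_le _ _).trans (add_le_add ?_ ?_)) ?_)
      · rw [abs_mul]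
        refine (mul_le_of_le_one_right (abs_nonneg _) ?_).trans (hM _ _)
        rw [levelIndicator]
        split_ifs <;> simp
      · split_ifs
        · exact hM' _ _
        · simpa using hM0'
      · split_ifs
        · exact hM' _ _
        · simpa using hM0'
    · rw [abs_zero]
      positivity
  · refine ⟨U, fun p x y h => ?_⟩
    have hp : p = e (N p) := by
      by_contra hp
      exact h (by rw [slabCone, if_neg hp])
    rw [slabCone, if_pos hp] at h
    generalize N p = n at hp h
    subst hp
    suffices |N x - n| ≤ |C₁| + |C₂| + 1 ∧ |N y - n| ≤ |C₁| + |C₂| + 1 from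
      ⟨hU _ _ this.1, hU _ _ this.2⟩
    have a1 := le_abs_self C₁
    have a2 := le_abs_self C₂
    have a3 := abs_nonneg C₁
    have a4 := abs_nonneg C₂
    by_cases h1 : c x y * levelIndicator N n x = 0
    · by_cases h2 : x = e n ∧ crossing N c n y ≠ 0
      · obtain ⟨rfl, h2⟩ := h2
        rw [hN.section_apply, sub_self, abs_zero]
        exact ⟨by omega, by linarith [hC₂ n y h2]⟩
      · have h3 : x = e (n + 1) ∧ crossing N c (n + 1) y ≠ 0 := by
          by_contra h3
          refine h ?_
          rw [closedSlab, h1, zero_add, sub_eq_zero]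
          trans 0
          · split_ifs with hx
            · simpa [hx] using h2
            · rfl
          · split_ifs with hx
            · simpa [hx, eq_comm] using h3
            · rfl
        obtain ⟨rfl, h3⟩ := h3
        have := abs_le.1 (hC₂ _ y h3)
        rw [hN.section_apply, abs_le, abs_le]
        omega
    · have hx : N x = n := by
        by_contra hx
        exact h1 (by simp [levelIndicator, hx])
      have := abs_le.1 (hC₁ x y (hT x y (left_ne_zero_of_mul h1)))
      rw [abs_le, abs_le]
      omega

variable (hcyc : ∀ y, edgeBoundary c y = 0)
include hcyc

/-- Away from the cone points this is `crossing_add_one`. At `e n` and `e (n + 1)` the extra outflow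
is the flux through a cut, which vanishes. -/
theorem IsCoarseLine.edgeBoundary_closedSlab (hflux : flux N c 0 = 0) (n : ℤ) (y : G) :
    ∑ᶠ z, closedSlab N e c n z y = ∑ᶠ z, closedSlab N e c n y z := by
  classical
  have hsing : ∀ (g : G) (t : ℝ), (Function.support fun z => if z = g then t else 0).Finite :=
    fun g t => (Set.finite_singleton g).subset fun z hz => by
      by_contra h
      exact hz (if_neg h)
  have hcr : ∀ (P : Prop) [Decidable P] (m : ℤ),
      (Function.support fun z => if P then crossing N c m z else 0).Finite := by
    intro P _ m
    split_ifs
    · exact hN.finite_support_crossing hc m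
    · simp
  have h1 : ∑ᶠ z, closedSlab N e c n z y = ∑ᶠ z, c z y * levelIndicator N n z +
      crossing N c n y - crossing N c (n + 1) y := by
    simp only [closedSlab]
    rw [finsum_sub_distrib _ (hsing _ _),
      finsum_add_distrib (hc.finite_support_left y _) (hsing _ _),
      finsum_eq_single (fun z => if z = e n then crossing N c n y else 0) (e n)
        fun z hz => if_neg hz,
      finsum_eq_single (fun z => if z = e (n + 1) then crossing N c (n + 1) y else 0) (e (n + 1))
        fun z hz => if_neg hz, if_pos rfl, if_pos rfl]
    exact ((hc.finite_support_left y _).union (hsing _ _)).subset (Function.support_add _ _)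
  have h0 : ∀ (P : Prop) [Decidable P] (m : ℤ),
      ∑ᶠ z, (if P then crossing N c m z else 0) = 0 := by
    intro P _ m
    split_ifs
    · exact (hN.flux_eq hc hcyc m).trans hflux
    · exact finsum_zero
  have h2 : ∑ᶠ z, closedSlab N e c n y z = levelIndicator N n y * ∑ᶠ z, c y z := by
    simp only [closedSlab]
    rw [finsum_sub_distrib _ (hcr _ _),
      finsum_add_distrib (hc.finite_support_right y fun _ => _) (hcr _ _), h0, h0, add_zero,
      sub_zero, mul_finsum]
    · exact finsum_congr fun z => mul_comm _ _
    · exact ((hc.finite_support_right y fun _ => _).union (hcr _ _)).subset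
        (Function.support_add _ _)
  rw [h1, h2, crossing_add_one hc hcyc]
  ring

/-- The slabs are cycles, so the two faces containing the cone point cancel. The opposite face is
the sum of all slabs, in which the closing cones telescope and leave `c`. -/
theorem IsCoarseLine.triangleBoundary_slabCone (hflux : flux N c 0 = 0) (x y : G) :
    triangleBoundary (slabCone N e c) x y = c x y := by
  classical
  have h23 : ∑ᶠ z, slabCone N e c x z y = ∑ᶠ z, slabCone N e c x y z := by
    simp only [slabCone]
    split_ifs
    · exact hN.edgeBoundary_closedSlab hc hcyc hflux _ _
    · rfl
  -- If `x` is a cone point, its edges occur with sign `+` in slab `N x` and with sign `-` in slab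
  -- `N x - 1`.
  have hz : ∀ z, slabCone N e c z x y = (if z = e (N x) then c x y else 0) +
      (if z = x then (if x = e (N x) then crossing N c (N x) y else 0) else 0) -
      (if z = e (N x - 1) then (if x = e (N x) then crossing N c (N x) y else 0) else 0) := by
    intro z
    rw [slabCone]
    by_cases hz : z = e (N z)
    · rw [if_pos hz]
      generalize N z = n at hz
      subst hz
      rw [closedSlab]
      have hinj : ∀ m k, e m = e k ↔ m = k := fun m k =>
        ⟨fun h => by rw [← hN.section_apply m, h, hN.section_apply], fun h => by rw [h]⟩
      congr 1
      · congr 1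
        · by_cases hn : n = N x
          · simp [levelIndicator, hn]
          · rw [levelIndicator, if_neg (Ne.symm hn), if_neg (by rwa [hinj]), mul_zero]
        · by_cases hx : x = e n
          · subst hx
            simp [hN.section_apply]
          · rw [if_neg hx, if_neg (Ne.symm hx)]
      · by_cases hx : x = e (n + 1)
        · subst hx
          simp [hN.section_apply]
        · rw [if_neg hx]
          by_cases hn : n = N x - 1
          · subst hn
            rw [sub_add_cancel] at hx
            simp [hx]
          · rw [if_neg (by rwa [hinj])]
    · have hne : ∀ m, z ≠ e m := by
        rintro m rfl
        exact hz (by rw [hN.section_apply])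
      rw [if_neg hz, if_neg (hne _), if_neg (hne _)]
      by_cases hzx : z = x
      · subst hzx
        simp [hz]
      · simp [hzx]
  have hsing : ∀ (g : G) (t : ℝ), (Function.support fun z => if z = g then t else 0).Finite :=
    fun g t => (Set.finite_singleton g).subset fun z hz => by
      by_contra h
      exact hz (if_neg h)
  have hsum : ∀ (g : G) (t : ℝ), ∑ᶠ z, (if z = g then t else 0) = t := fun g t => by
    rw [finsum_eq_single _ g fun z hz => if_neg hz, if_pos rfl]
  rw [triangleBoundary, h23, sub_add_cancel, finsum_congr hz, finsum_sub_distrib _ (hsing _ _),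
    finsum_add_distrib (hsing _ _) (hsing _ _), hsum, hsum, hsum, add_sub_cancel_right]
  exact ((hsing _ _).union (hsing _ _)).subset (Function.support_add _ _)

end

end CoarseLine

/-! ### Flux as an isomorphism from homology to `ℝ` -/

section FluxHom

variable {G : Type*} [Group G] {S : Set G} (hfin : S.Finite) (hS : Subgroup.closure S = ⊤)

/-- The flow of a `1`-cycle across the cut `{x | N x < 0}` as a linear functional. -/
noncomputable def fluxHom {N : G → ℤ} {e : ℤ → G} (hN : IsCoarseLine N e) :
    ufCycles (WordMetricSpace S hS) 1 →ₗ[ℝ] ℝ where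
  toFun c := flux N (c.1.edge hS) 0
  map_add' c c' := by
    have hc := c.1.isUFEdgeChain_edge hfin hS
    have hc' := c'.1.isUFEdgeChain_edge hfin hS
    rw [flux, flux, flux, ← finsum_add_distrib (hN.finite_support_crossing hc 0)
      (hN.finite_support_crossing hc' 0)]
    refine finsum_congr fun y => ?_
    rw [crossing, crossing, crossing, ← finsum_add_distrib (hc.finite_support_left y _)
      (hc'.finite_support_left y _)]
    exact finsum_congr fun x => add_mul _ _ _
  map_smul' t c := by
    rw [flux, flux, RingHom.id_apply, smul_finsum]
    refine finsum_congr fun y => ?_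
    rw [crossing, crossing, smul_finsum]
    exact finsum_congr fun x => mul_assoc _ _ _

include hfin in
theorem IsCoarseLine.mem_submoduleOf_of_flux_eq_zero {N : G → ℤ} {e : ℤ → G}
    (hN : IsCoarseLine N e) {c : ufCycles (WordMetricSpace S hS) 1}
    (h : flux N (c.1.edge hS) 0 = 0) :
    c ∈ (ufBoundaries (WordMetricSpace S hS) 1).submoduleOf (ufCycles (WordMetricSpace S hS) 1) :=
  have hc := c.1.isUFEdgeChain_edge hfin hS
  (mem_submoduleOf_ufBoundaries_iff hfin hS c).2 ⟨slabCone N e (c.1.edge hS),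
    hN.isUFTriangleChain_slabCone hc, funext fun x => funext fun y =>
      (hN.triangleBoundary_slabCone hc ((mem_ufCycles_iff hS c.1).1 c.2) h x y).symm⟩

include hfin in
/-- If `G` is coarsely a line and some cycle does not bound, then `H₁` is one-dimensional. -/
theorem IsCoarseLine.nonempty_ufHomology_one_equiv {N : G → ℤ} {e : ℤ → G}
    (hN : IsCoarseLine N e) {z : ufCycles (WordMetricSpace S hS) 1}
    (hz : z ∉ (ufBoundaries (WordMetricSpace S hS) 1).submoduleOf
      (ufCycles (WordMetricSpace S hS) 1)) :
    Nonempty (UFHomology (WordMetricSpace S hS) 1 ≃ₗ[ℝ] ℝ) := by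
  set B := (ufBoundaries (WordMetricSpace S hS) 1).submoduleOf (ufCycles (WordMetricSpace S hS) 1)
  let F := fluxHom hfin hS hN
  have hker : LinearMap.ker F ≤ B := fun c hc => hN.mem_submoduleOf_of_flux_eq_zero hfin hS hc
  -- No flux of a boundary is computed: a boundary of nonzero flux could be used to cancel the flux
  -- of `z`, and then `z` itself would bound.
  have hle : B ≤ LinearMap.ker F := by
    intro b hb
    by_contra hFb
    rw [LinearMap.mem_ker] at hFb
    refine hz ?_
    have h1 : z - (F z / F b) • b ∈ B := hker (by
      rw [LinearMap.mem_ker, map_sub, map_smul, smul_eq_mul, div_mul_cancel₀ _ hFb, sub_self])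
    simpa using B.add_mem h1 (B.smul_mem (F z / F b) hb)
  have hFz : F z ≠ 0 := fun h => hz (hker h)
  have hsurj : Function.Surjective F := fun t =>
    ⟨(t / F z) • z, by rw [map_smul, smul_eq_mul, div_mul_cancel₀ _ hFz]⟩
  exact ⟨(Submodule.quotEquivOfEq _ _ (le_antisymm hle hker)).trans
    (LinearMap.quotKerEquivOfSurjective F hsurj)⟩

end FluxHom

/-! ### Homomorphisms to `ℤ` and virtually cyclic groups -/

section VirtuallyInt

variable {G : Type*} [Group G]

/-- A finitely generated group whose abelianization is not torsion maps nontrivially to `ℤ`. -/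
theorem exists_hom_int_ne_one {S : Set G} (hfin : S.Finite) (hS : Subgroup.closure S = ⊤)
    (h : ¬ IsMulTorsion (Abelianization G)) :
    ∃ (φ : G →* Multiplicative ℤ) (g : G), 0 < (φ g).toAdd := by
  have hFG : Group.FG G := Group.fg_iff.2 ⟨S, hS, hfin⟩
  have hFG' : Group.FG (Abelianization G) :=
    Group.fg_of_surjective (f := Abelianization.of) QuotientGroup.mk_surjective
  have : Module.Finite ℤ (Additive (Abelianization G)) :=
    Module.Finite.iff_addGroup_fg.2 (AddGroup.fg_iff_mul_fg.2 (by exact hFG'))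
  unfold IsMulTorsion at h
  push Not at h
  obtain ⟨a, ha⟩ := h
  let A := Additive (Abelianization G)
  -- Modulo torsion the abelianization is free of finite rank, so an element of infinite order has a
  -- nonzero coordinate there.
  let Q := A ⧸ Submodule.torsion ℤ A
  let π : A →ₗ[ℤ] Q := Submodule.mkQ _
  have hπ : π (Additive.ofMul a) ≠ 0 := by
    intro h0
    rw [Submodule.mkQ_apply, Submodule.Quotient.mk_eq_zero, Submodule.mem_torsion_iff] at h0
    obtain ⟨⟨n, hn⟩, h0⟩ := h0
    refine ha (isOfFinOrder_iff_zpow_eq_one.2 ⟨n, nonZeroDivisors.ne_zero hn, ?_⟩)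
    exact congrArg Additive.toMul h0
  let bas := Module.Free.chooseBasis ℤ Q
  obtain ⟨i, hi⟩ : ∃ i, bas.coord i (π (Additive.ofMul a)) ≠ 0 := by
    by_contra! h0
    exact hπ (bas.forall_coord_eq_zero_iff.1 h0)
  let ψ : G →* Multiplicative ℤ :=
    (AddMonoidHom.toMultiplicativeRight (bas.coord i ∘ₗ π).toAddMonoidHom).comp Abelianization.of
  obtain ⟨g, rfl⟩ := QuotientGroup.mk_surjective a
  have hψ : (ψ g).toAdd ≠ 0 := hi
  rcases hψ.lt_or_gt with hlt | hlt
  · exact ⟨ψ, g⁻¹, by simpa using hlt⟩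
  · exact ⟨ψ, g, hlt⟩

theorem isVirtuallyInt_of_finiteIndex_zpowers {φ : G →* Multiplicative ℤ} {g : G}
    (hg : 0 < (φ g).toAdd) (h : (Subgroup.zpowers g).FiniteIndex) : IsVirtuallyInt G := by
  refine ⟨_, h, ⟨?_⟩⟩
  have hinj : Function.Injective (zpowersHom G g) := by
    rw [injective_iff_map_eq_one]
    intro n hn
    rw [zpowersHom_apply] at hn
    have := congrArg (fun x => (φ x).toAdd) hn
    simp only [map_zpow, toAdd_zpow, map_one, toAdd_one, smul_eq_mul, mul_eq_zero, hg.ne',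
      or_false] at this
    exact this
  exact ((MonoidHom.ofInjective hinj).trans (MulEquiv.subgroupCongr (by
    ext x
    rw [Subgroup.mem_zpowers_iff]
    rfl))).symm

/-- Some positive power of `g` lies in `H`, so `φ` is nonzero on `H ≅ ℤ` and hence injective there.
The kernel thus meets `H` trivially and embeds in the finite set `G ⧸ H`. -/
theorem IsVirtuallyInt.finite_ker (hG : IsVirtuallyInt G) {φ : G →* Multiplicative ℤ} {g : G}
    (hg : 0 < (φ g).toAdd) : Finite φ.ker := by
  obtain ⟨H, hH, ⟨f⟩⟩ := hG
  have hdisj : ∀ x ∈ H, φ x = 1 → x = 1 := by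
    obtain ⟨k, hk, -, hkH⟩ := Subgroup.exists_pow_mem_of_index_ne_zero hH.index_ne_zero g
    let t : H := f.symm (Multiplicative.ofAdd 1)
    have ht : ∀ x : H, x = t ^ (f x).toAdd := by
      intro x
      apply f.injective
      rw [map_zpow, f.apply_symm_apply, ← ofAdd_zsmul, smul_eq_mul, mul_one, ofAdd_toAdd]
    have hφ : ∀ x : H, (φ x).toAdd = (f x).toAdd * (φ t).toAdd := by
      intro x
      conv_lhs => rw [ht x]
      simp
    have ht0 : (φ t).toAdd ≠ 0 := by
      intro h0
      have h1 := hφ ⟨_, hkH⟩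
      rw [h0, mul_zero] at h1
      simp only [map_pow, toAdd_pow, nsmul_eq_mul] at h1
      have : (0 : ℤ) < k * (φ g).toAdd := by positivity
      omega
    intro x hx h1
    have h2 := hφ ⟨x, hx⟩
    rw [h1, toAdd_one, eq_comm, mul_eq_zero, or_iff_left ht0] at h2
    have h3 := ht ⟨x, hx⟩
    rw [h2, zpow_zero] at h3
    exact congrArg Subtype.val h3
  have : Finite (G ⧸ H) := H.finite_quotient_of_finiteIndex
  refine Finite.of_injective (fun x : φ.ker => (x : G ⧸ H)) fun x y hxy => ?_
  have h1 := hdisj _ (QuotientGroup.eq.1 hxy) (by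
    rw [map_mul, map_inv, MonoidHom.mem_ker.1 x.2, MonoidHom.mem_ker.1 y.2, inv_one, one_mul])
  exact Subtype.ext (inv_mul_eq_one.1 h1)

theorem finite_preimage_toAdd {φ : G →* Multiplicative ℤ} [Finite φ.ker] {s : Set ℤ}
    (hs : s.Finite) : ((fun x => (φ x).toAdd) ⁻¹' s).Finite := by
  refine hs.preimage' fun n _ => ?_
  by_cases h : ∃ y, (φ y).toAdd = n
  · obtain ⟨y, rfl⟩ := h
    refine ((Set.toFinite (φ.ker : Set G)).image (y * ·)).subset fun x hx => ⟨y⁻¹ * x, ?_, by simp⟩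
    have hx' : φ x = φ y := hx
    rw [SetLike.mem_coe, MonoidHom.mem_ker, map_mul, map_inv, hx', inv_mul_cancel]
  · refine Set.finite_empty.subset fun x hx => h ⟨x, hx⟩

theorem isCoarseLine_of_finite_ker {φ : G →* Multiplicative ℤ} [Finite φ.ker] {g : G}
    (hg : 0 < (φ g).toAdd) :
    IsCoarseLine (fun x => (φ x).toAdd / (φ g).toAdd) fun n => g ^ n := by
  refine ⟨fun n => ?_, fun T => ⟨∑ s ∈ T, |(φ s).toAdd|, fun x y h => ?_⟩, fun C => ?_⟩
  · simp [hg.ne']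
  · have h1 := Finset.single_le_sum (f := fun s => |(φ s).toAdd|) (fun s _ => abs_nonneg _) h
    refine le_trans ?_ h1
    have hy : (φ y).toAdd = (φ x).toAdd + (φ (x⁻¹ * y)).toAdd := by
      rw [← toAdd_mul, ← map_mul, mul_inv_cancel_left]
    simp only [hy]
    generalize (φ x).toAdd = a
    generalize (φ (x⁻¹ * y)).toAdd = b
    generalize (φ g).toAdd = d at hg
    -- Replacing `b` by multiples of `d` lets the change pass exactly through the floor division.
    have hb : |b| ≤ |b| * d := le_mul_of_one_le_right (abs_nonneg b) hg
    have hb1 := neg_abs_le b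
    have hb2 := le_abs_self b
    have h2 : (a + b) / d ≤ (a + |b| * d) / d := Int.ediv_le_ediv hg (by linarith)
    have h3 : (a + -|b| * d) / d ≤ (a + b) / d := Int.ediv_le_ediv hg (by linarith)
    rw [Int.add_mul_ediv_right _ _ hg.ne'] at h2 h3
    rw [abs_le]
    constructor <;> linarith
  · have hf := finite_preimage_toAdd (φ := φ)
      -- The extra `φ g` at the upper end absorbs the remainder of the division.
      (Set.finite_Icc (-((φ g).toAdd * C)) ((φ g).toAdd * C + (φ g).toAdd))
    refine ⟨hf.toFinset, fun n x h => ?_⟩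
    rw [Set.Finite.mem_toFinset, Set.mem_preimage, Set.mem_Icc]
    simp only [map_mul, map_inv, map_zpow, toAdd_mul, toAdd_inv, toAdd_zpow, smul_eq_mul]
    generalize (φ x).toAdd = a at h
    generalize (φ g).toAdd = d at hg h
    have h1 := Int.mul_ediv_add_emod a d
    have h2 := Int.emod_nonneg a hg.ne'
    have h3 := Int.emod_lt_of_pos a hg
    obtain ⟨h4, h5⟩ := abs_le.1 h
    have h6 := mul_le_mul_of_nonneg_left h4 hg.le
    have h7 := mul_le_mul_of_nonneg_left h5 hg.le
    rw [mul_sub] at h6 h7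
    constructor <;> nlinarith

end VirtuallyInt

theorem corollary4p1 {G : Type*} [Group G] (S : Set G) (hfin : S.Finite)
    (hS : Subgroup.closure S = ⊤) (hamen : IsAmenableGroup G)
    (htors : ¬ IsMulTorsion (Abelianization G)) :
    (IsVirtuallyInt G → Nonempty (UFHomology (WordMetricSpace S hS) 1 ≃ₗ[ℝ] ℝ)) ∧
      (¬ IsVirtuallyInt G → ¬ Module.Finite ℝ (UFHomology (WordMetricSpace S hS) 1)) := by
  obtain ⟨φ, g, hg⟩ := exists_hom_int_ne_one hfin hS htors
  have hφ : ∀ x y, ((φ (x * y)).toAdd : ℝ) = (φ x).toAdd + (φ y).toAdd := fun x y => by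
    rw [map_mul, toAdd_mul, Int.cast_add]
  have hg' : ((φ g).toAdd : ℝ) ≠ 0 := by exact_mod_cast hg.ne'
  constructor
  · intro hG
    have := hG.finite_ker hg
    refine (isCoarseLine_of_finite_ker hg).nonempty_ufHomology_one_equiv hfin hS
      -- With `f = 1` all averages equal `1`, so this cycle cannot bound.
      (z := flowCycle hfin hS (g := g) (f := fun _ => 1) (M := 1) (by simp) (by simp)) ?_
    rw [mem_submoduleOf_ufBoundaries_iff hfin hS]
    rintro ⟨b, hb, h⟩
    obtain ⟨p, hp⟩ := hamen.exists_isReiterSequence hfin hS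
    have hlim := hp.tendsto_of_flowChain_eq (φ := fun x => ((φ x).toAdd : ℝ)) hφ hg' hb h
    simp only [mul_one, hp.sum_eq_one] at hlim
    exact one_ne_zero (tendsto_nhds_unique tendsto_const_nhds hlim)
  · exact fun hG => not_finite_ufHomology_one hfin hS hamen
      (φ := fun x => ((φ x).toAdd : ℝ)) hφ hg'
      fun h => hG (isVirtuallyInt_of_finiteIndex_zpowers hg h)
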